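/- Let $d\ge 1$. For a finite alphabet $A$, a nearest neighbor $\mathbb{Z}^d$ shift of finite type (SFT) over $A$ is a nonempty set $X\subseteq A^{\mathbb{Z}^d}$ of the form $$X=\{x : (x(v),x(v+e_i))\notin F_i \text{ for all } v\in\mathbb{Z}^d,\ 1\le i\le d\}$$ for some sets $F_1,\dots,F_d\subseteq A\times A$. Its topological entropy is $h(X)=\lim_{n_1,\dots,n_d\to\infty}\frac{1}{n_1\cdots n_d}\log|L_{n}(X)|$, where $L_n(X)$ is the set of restrictions of points of $X$ to $\prod_i[1,n_i]$. The entropy of a shift-invariant Borel probability measure $\mu$ on $A^{\mathbb{Z}^d}$ is $h(\mu)=\lim_{n_1,\dots,n_d\to\infty}\frac{-1}{n_1\cdots n_d}\sum_{w}\mu([w])\log\mu([w])$, the sum being over all $w\in A^{\prod_i[1,n_i]}$, where $[w]$ is the set of points that restrict to $w$ (and $0\log 0=0$). A measure of maximal entropy on $X$ is such a $\mu$ with $\mu(X)=1$ and $h(\mu)=h(X)$. Let $$\alpha_d=\inf\{\alpha\in\mathbb{R} : \text{there are a finite alphabet } A \text{ and a nearest neighbor } \mathbb{Z}^d \text{ SFT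 } X \text{ over } A \text{ with more than one measure of maximal entropy and } h(X)\ge \log|A|-\alpha\}.$$ Then $\alpha_1=\log 2$. More precisely: 1. If a nearest neighbor $\mathbb{Z}$ SFT $X$ over a finite alphabet $A$ has more than one measure of maximal entropy, then $X$ has at least two distinct irreducible components of entropy $h(X)$, and $\log|A|-h(X)\ge\log 2$. Here letters $a,b$ communicate if there are paths of positive length from $a$ to $b$ and from $b$ to $a$ in the directed graph on $A$ whose edges are the pairs of consecutive letters occurring in points of $X$, and an irreducible component is the set of all points of $X$ all of whose letters communicate with a given letter $a$ that communicates with itself. 2. For every $n\ge 1$, the union $X$ of two full shifts $A_1^{\mathbb{Z}}$ and $A_2^{\mathbb{Z}}$ with $|A_1|=|A_2|=n$, $A_1\cap A_2=\varnothing$, viewed over $A=A_1\sqcup A_2$, is a nearest neighbor $\mathbb{Z}$ SFT with more than one measure of maximal entropy, and $\log|A|-h(X)=\log 2$. -/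

import Mathlib

open Filter MeasureTheory

/-- The full shift `A^(ℤ^d)`. -/
def FullShift (d : ℕ) (A : Type) : Type := (Fin d → ℤ) → A

namespace FullShift

/-- The product of the discrete topologies. -/
instance instTopologicalSpace (d : ℕ) (A : Type) : TopologicalSpace (FullShift d A) :=
  @Pi.topologicalSpace (Fin d → ℤ) (fun _ => A) (fun _ => ⊥)

/-- The product of the discrete `σ`-algebras; for a finite alphabet it is the Borel `σ`-algebra,
see `instBorelSpace`. -/
instance instMeasurableSpace (d : ℕ) (A : Type) : MeasurableSpace (FullShift d A) :=
  @MeasurableSpace.pi (Fin d → ℤ) (fun _ => A) (fun _ => ⊤)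

instance instBorelSpace (d : ℕ) (A : Type) [Finite A] : BorelSpace (FullShift d A) := by
  let _ : TopologicalSpace A := ⊥
  let _ : MeasurableSpace A := ⊤
  have : DiscreteTopology A := ⟨rfl⟩
  have : BorelSpace A := ⟨borel_eq_top_of_discrete.symm⟩
  exact (inferInstance : BorelSpace ((Fin d → ℤ) → A))

/-- The shift action, `(σ_t x)(s) = x(s + t)`. -/
def shift {d : ℕ} {A : Type} (t : Fin d → ℤ) (x : FullShift d A) : FullShift d A :=
  fun s => x (s + t)

end FullShift

/-- `X` is a (nonempty) nearest neighbor `ℤ^d` shift of finite type over the alphabet `A`: for some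
sets `F i` of forbidden pairs of letters at sites `v` and `v + e_i`, it consists of all the
configurations in which no forbidden pair occurs. -/
def IsNearestNeighborSFT {d : ℕ} {A : Type} (X : Set (FullShift d A)) : Prop :=
  X.Nonempty ∧ ∃ F : Fin d → Set (A × A),
    X = {x | ∀ (i : Fin d) (v : Fin d → ℤ), (x v, x (v + Pi.single i 1)) ∉ F i}

/-- `L_S(X)`: the configurations of shape `S` that appear in points of `X`. -/
def languageOn {d : ℕ} {A : Type} (X : Set (FullShift d A)) (S : Finset (Fin d → ℤ)) :
    Set (S → A) :=
  {w | ∃ x ∈ X, ∀ s : S, x s = w s}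

/-- The cylinder set `[w]` of a configuration `w` of shape `S`, in the full shift. -/
def cylinderSet {d : ℕ} {A : Type} {S : Finset (Fin d → ℤ)} (w : S → A) : Set (FullShift d A) :=
  {x | ∀ s : S, x s = w s}

/-- The box `[1, n_1] × ⋯ × [1, n_d]`. -/
noncomputable def box {d : ℕ} (n : Fin d → ℕ) : Finset (Fin d → ℤ) :=
  Fintype.piFinset fun i => Finset.Icc (1 : ℤ) (n i)

/-- Topological entropy: the limit of `log |L_{box n}(X)| / ∏ n_i` as all `n_i → ∞`
(`atTop` on `Fin d → ℕ` is taken for the coordinatewise order). -/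
noncomputable def topologicalEntropy {d : ℕ} {A : Type} (X : Set (FullShift d A)) : ℝ :=
  limUnder atTop fun n : Fin d → ℕ =>
    Real.log ((languageOn X (box n)).ncard : ℝ) / ∏ i, (n i : ℝ)

/-- Measure-theoretic entropy: the limit of `(-∑_w μ[w] log μ[w]) / ∏ n_i` as all `n_i → ∞`,
`w` running over the configurations of shape `box n`. -/
noncomputable def measureEntropy {d : ℕ} {A : Type} [Fintype A] (μ : Measure (FullShift d A)) :
    ℝ :=
  limUnder atTop fun n : Fin d → ℕ =>
    (∑ w : box n → A, Real.negMulLog (μ.real (cylinderSet w))) / ∏ i, (n i : ℝ)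

/-- The measures of maximal entropy on `X`: the shift-invariant Borel probability measures
supported in `X` whose entropy is that of `X`. -/
structure IsMeasureOfMaximalEntropy {d : ℕ} {A : Type} [Fintype A] (X : Set (FullShift d A))
    (μ : Measure (FullShift d A)) : Prop where
  isProbabilityMeasure : IsProbabilityMeasure μ
  invariant : ∀ t : Fin d → ℤ, MeasurePreserving (FullShift.shift t) μ μ
  supported : μ Xᶜ = 0
  entropy_eq : measureEntropy μ = topologicalEntropy X

/-- `X` has more than one measure of maximal entropy. -/
def HasMultipleMME {d : ℕ} {A : Type} [Fintype A] (X : Set (FullShift d A)) : Prop :=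
  ∃ μ ν : Measure (FullShift d A),
    IsMeasureOfMaximalEntropy X μ ∧ IsMeasureOfMaximalEntropy X ν ∧ μ ≠ ν

/-- `α_d`: the infimum of all `α` for which some nearest neighbor `ℤ^d` SFT `X`, over some finite
alphabet `A`, has more than one measure of maximal entropy and `h(X) ≥ log |A| - α`. -/
noncomputable def alphaCrit (d : ℕ) : ℝ :=
  sInf {α : ℝ | ∃ (A : Type) (_ : Fintype A) (X : Set (FullShift d A)),
    IsNearestNeighborSFT X ∧ HasMultipleMME X ∧
      topologicalEntropy X ≥ Real.log (Fintype.card A) - α}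

/-- The letter `b` follows the letter `a` in some point of the `ℤ` subshift `X`. -/
def Follows {A : Type} (X : Set (FullShift 1 A)) (a b : A) : Prop :=
  ∃ x ∈ X, ∃ v : Fin 1 → ℤ, x v = a ∧ x (v + Pi.single 0 1) = b

/-- There are paths (with at least one step) from `a` to `b` and from `b` to `a` in the graph of
the relation `Follows X`. -/
def Communicates {A : Type} (X : Set (FullShift 1 A)) (a b : A) : Prop :=
  Relation.TransGen (Follows X) a b ∧ Relation.TransGen (Follows X) b a

/-- `Y` is an irreducible component of the nearest neighbor `ℤ` SFT `X`: the set of the points of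
`X` all of whose letters lie in one communicating class, that of a letter `a` which communicates
with itself (so that `Y` is nonempty). -/
def IsIrreducibleComponent {A : Type} (X Y : Set (FullShift 1 A)) : Prop :=
  ∃ a : A, Communicates X a a ∧ Y = {x ∈ X | ∀ v, Communicates X a (x v)}

/-- The union of two disjoint full `ℤ` shifts on `n` symbols each; its alphabet is the disjoint
union `Fin n ⊕ Fin n`. -/
def twoFullShifts (n : ℕ) : Set (FullShift 1 (Fin n ⊕ Fin n)) :=
  {x | ∀ v, ∃ a : Fin n, x v = Sum.inl a} ∪ {x | ∀ v, ∃ a : Fin n, x v = Sum.inr a}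

/-! Consider the directed graph on the alphabet whose edges are the pairs of consecutive letters of
points of `X`. An invariant measure puts no mass on an edge that leaves a communicating class, since
mass that flows out never returns (`mem_communicatingClass_of_pair_pos`). Each class has a Perron
eigenvalue `lam` with a positive eigenvector `r`. Counting its paths with weight `r` shows that the
corresponding component has entropy `log lam`, so `log lam ≤ h(X)`.

Gibbs' inequality compares the law of the next letter given the past with Parry's kernel `r b / (lam
a * r a)`. The terms `log r` cancel by stationarity, and the entropy of the measure is at most the
average of `log lam` over its letters. For a measure of maximal entropy all these inequalities are
equalities: it lives on classes with `log lam = h(X)` and is Markov with Parry's kernel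
(`markov_of_le_entropyRate`). The existence of such a measure also shows that some class attains
`h(X)`, so no upper bound for `h(X)` by its components is proved separately.

If only one class attains `h(X)`, the letter law is the unique stationary vector of an irreducible
kernel, so all block probabilities, and hence the measure, are determined. Two measures therefore
force two disjoint classes with `lam = exp h(X)`. As an eigenvalue is at most the size of its class,
`2 * exp h(X) ≤ |A|`. Two disjoint full shifts, with their uniform Bernoulli measures, show that the
bound is sharp. -/

open scoped Matrix

/-! ### Perron–Frobenius existence by the Collatz–Wielandt maximum -/

/-- A vector with positive coordinates dominates a positive multiple of any other vector. -/
theorem exists_pos_smul_le_of_pos {ι : Type*} [Fintype ι] (x y : ι → ℝ)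
    (hy : ∀ i, 0 < y i) : ∃ ε > 0, ∀ i, ε * x i ≤ y i := by
  classical
  have hev : ∀ᶠ ε : ℝ in nhdsWithin 0 (Set.Ioi 0), ∀ i, ε * x i ≤ y i := by
    rw [eventually_all]
    intro i
    have h : Tendsto (fun ε : ℝ => ε * x i) (nhdsWithin 0 (Set.Ioi 0)) (nhds 0) := by
      have : Tendsto (fun ε : ℝ => ε * x i) (nhds 0) (nhds (0 * x i)) :=
        (continuous_id.mul continuous_const).tendsto 0
      rw [zero_mul] at this
      exact this.mono_left nhdsWithin_le_nhds
    exact (h.eventually (gt_mem_nhds (hy i))).mono fun _ h => h.le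
  obtain ⟨ε, h, hε⟩ := (hev.and self_mem_nhdsWithin).exists
  exact ⟨ε, hε, h⟩

/-- The existence part of the Perron–Frobenius theorem for irreducible nonnegative matrices. -/
theorem Matrix.exists_pos_eigenvector {ι : Type*} [Fintype ι] [DecidableEq ι] [Nonempty ι]
    (M : Matrix ι ι ℝ) (hM : ∀ a b, 0 ≤ M a b) (hirr : ∀ a b, ∃ k, 0 < (M ^ k) a b)
    (hcol : ∀ b, ∃ a, 0 < M a b) :
    ∃ t : ℝ, 0 < t ∧ ∃ x : ι → ℝ, (∀ a, 0 < x a) ∧ M *ᵥ x = t • x := by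
  set c : ℝ := ∑ a, ∑ b, M a b with hc
  have hc0 : 0 ≤ c := Finset.sum_nonneg fun a _ => Finset.sum_nonneg fun b _ => hM a b
  -- The eigenvalue is the largest `t` for which some `x` in the simplex satisfies `t x ≤ M x`. The
  -- bound `c` on `t` only serves to make this set compact.
  let K : Set ((ι → ℝ) × ℝ) :=
    (stdSimplex ℝ ι ×ˢ Set.Icc 0 c) ∩ {z | ∀ a, z.2 * z.1 a ≤ (M *ᵥ z.1) a}
  have hKc : IsCompact K := by
    refine ((isCompact_stdSimplex ℝ ι).prod isCompact_Icc).inter_right ?_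
    simp only [Set.ofPred_forall]
    refine isClosed_iInter fun a => isClosed_le (by fun_prop) ?_
    simp only [Matrix.mulVec, dotProduct]
    fun_prop
  have hbound : ∀ x ∈ stdSimplex ℝ ι, ∀ t : ℝ, (∀ a, t * x a ≤ (M *ᵥ x) a) → t ≤ c := by
    intro x hx t ht
    have h1 : ∑ a, t * x a ≤ ∑ a, (M *ᵥ x) a := Finset.sum_le_sum fun a _ => ht a
    rw [← Finset.mul_sum, hx.2, mul_one] at h1
    refine h1.trans (Finset.sum_le_sum fun a _ => Finset.sum_le_sum fun b _ => ?_)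
    have hxb : x b ≤ 1 := by
      rw [← hx.2]
      exact Finset.single_le_sum (fun i _ => hx.1 i) (Finset.mem_univ b)
    exact mul_le_of_le_one_right (hM a b) hxb
  have hKn : K.Nonempty := by
    obtain ⟨i⟩ := ‹Nonempty ι›
    refine ⟨(Pi.single i 1, 0), ⟨single_mem_stdSimplex ℝ i, le_refl _, hc0⟩, fun a => ?_⟩
    simp only [zero_mul]
    exact Finset.sum_nonneg fun b _ =>
      mul_nonneg (hM a b) ((single_mem_stdSimplex ℝ i).1 b)
  obtain ⟨⟨x, t⟩, ⟨⟨hx, ht0, -⟩, hxt⟩, hmax⟩ :=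
    hKc.exists_isMaxOn hKn continuous_snd.continuousOn
  simp only [Set.mem_ofPred_eq] at hx ht0 hxt
  have hmax' : ∀ y : ι → ℝ, (∀ a, 0 < y a) → ∀ s : ℝ, (∀ a, s * y a ≤ (M *ᵥ y) a) → s ≤ t := by
    intro y hy s hs
    by_contra! hlt
    have hsum : 0 < ∑ a, y a := Finset.sum_pos (fun a _ => hy a) Finset.univ_nonempty
    have hz : (∑ a, y a)⁻¹ • y ∈ stdSimplex ℝ ι := by
      refine ⟨fun a => by have := hy a; simp only [Pi.smul_apply, smul_eq_mul]; positivity, ?_⟩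
      simp only [Pi.smul_apply, smul_eq_mul, ← Finset.mul_sum]
      exact inv_mul_cancel₀ hsum.ne'
    have hz2 : ∀ a, s * ((∑ a, y a)⁻¹ • y) a ≤ (M *ᵥ ((∑ a, y a)⁻¹ • y)) a := by
      intro a
      rw [Matrix.mulVec_smul]
      simp only [Pi.smul_apply, smul_eq_mul]
      have := mul_le_mul_of_nonneg_left (hs a) (inv_nonneg.2 hsum.le)
      linarith
    have := hmax (show ((∑ a, y a)⁻¹ • y, s) ∈ K from
      ⟨⟨hz, ht0.trans hlt.le, hbound _ hz _ hz2⟩, hz2⟩)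
    exact absurd this (not_le.2 hlt)
  choose k hk using hirr
  -- A sum of powers with all entries positive: it commutes with `M` and turns nonzero nonnegative
  -- vectors into positive ones.
  let B : Matrix ι ι ℝ := ∑ a, ∑ b, M ^ k a b
  have hBM : M * B = B * M := by
    simp only [B, Finset.mul_sum, Finset.sum_mul]
    simp only [← pow_succ, ← pow_succ']
  have hBpos : ∀ a b, 0 < B a b := by
    intro a b
    simp only [B, Matrix.sum_apply]
    refine (hk a b).trans_le ?_
    refine le_trans ?_ (Finset.single_le_sum (f := fun i => ∑ j, (M ^ k i j) a b)
      (fun i _ => Finset.sum_nonneg fun j _ => Matrix.pow_apply_nonneg hM _ _ _)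
      (Finset.mem_univ a))
    exact Finset.single_le_sum (f := fun j => (M ^ k a j) a b)
      (fun j _ => Matrix.pow_apply_nonneg hM _ _ _) (Finset.mem_univ b)
  have hBv : ∀ v : ι → ℝ, (∀ a, 0 ≤ v a) → v ≠ 0 → ∀ a, 0 < (B *ᵥ v) a := by
    intro v hv hv0 a
    obtain ⟨b, hb⟩ := Function.ne_iff.1 hv0
    exact Finset.sum_pos' (fun c _ => mul_nonneg (hBpos a c).le (hv c))
      ⟨b, Finset.mem_univ b, mul_pos (hBpos a b) (lt_of_le_of_ne (hv b) (Ne.symm hb))⟩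
  have hx0 : x ≠ 0 := by
    rintro rfl
    have := hx.2
    simp at this
  -- Otherwise `B` makes the defect `M x - t x` positive, so `B x` satisfies the inequality with `t
  -- + ε`, against maximality.
  have heig : M *ᵥ x = t • x := by
    by_contra hne
    have hy := hBv (M *ᵥ x - t • x) (fun a => by simpa using hxt a) (sub_ne_zero.2 hne)
    obtain ⟨ε, hε, hle⟩ := exists_pos_smul_le_of_pos (B *ᵥ x) _ hy
    have := hmax' (B *ᵥ x) (hBv x hx.1 hx0) (t + ε) fun a => by
      have h1 := hle a
      rw [Matrix.mulVec_sub, Matrix.mulVec_smul] at h1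
      rw [Matrix.mulVec_mulVec, hBM, ← Matrix.mulVec_mulVec]
      simp only [Pi.sub_apply, Pi.smul_apply, smul_eq_mul] at h1
      linarith
    linarith
  have hpow : ∀ j, M ^ j *ᵥ x = t ^ j • x := by
    intro j
    induction j with
    | zero => simp
    | succ j ih => rw [pow_succ, ← Matrix.mulVec_mulVec, heig, Matrix.mulVec_smul, ih, smul_smul,
        pow_succ, mul_comm]
  obtain ⟨b, hb⟩ := Function.ne_iff.1 hx0
  have hb : 0 < x b := lt_of_le_of_ne (hx.1 b) (Ne.symm hb)
  have key : ∀ j a, 0 < (M ^ j) a b → 0 < t ^ j * x a := by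
    intro j a hj
    have : (M ^ j *ᵥ x) a = t ^ j * x a := by rw [hpow]; rfl
    rw [← this]
    exact Finset.sum_pos' (fun c _ => mul_nonneg (Matrix.pow_apply_nonneg hM _ _ _) (hx.1 c))
      ⟨b, Finset.mem_univ b, mul_pos hj hb⟩
  refine ⟨t, ?_, x, fun a => ?_, heig⟩
  -- The exponents in `hirr` may be `0`, so the `1 × 1` zero matrix satisfies it; `hcol` is what
  -- forces `t > 0`.
  · obtain ⟨a, ha⟩ := hcol b
    have := key 1 a (by simpa using ha)
    rw [pow_one] at this
    exact pos_of_mul_pos_left this (hx.1 a)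
  · exact pos_of_mul_pos_right (key _ a (hk a b)) (pow_nonneg ht0 _)

/-! ### Communicating classes and their eigenvectors -/

/-- The set of letters that communicate with `a` in the graph of the relation `E`. -/
def communicatingClass {A : Type} (E : A → A → Prop) (a : A) : Set A :=
  {b | Relation.TransGen E a b ∧ Relation.TransGen E b a}

theorem communicatingClass_eq_of_mem {A : Type} {E : A → A → Prop} {a b : A}
    (h : b ∈ communicatingClass E a) : communicatingClass E b = communicatingClass E a := by
  ext c
  exact ⟨fun hc => ⟨h.1.trans hc.1, hc.2.trans h.2⟩, fun hc => ⟨h.2.trans hc.1, hc.2.trans h.1⟩⟩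

theorem mem_communicatingClass_comm {A : Type} {E : A → A → Prop} {a b : A} :
    b ∈ communicatingClass E a ↔ a ∈ communicatingClass E b :=
  and_comm

theorem self_mem_of_mem_communicatingClass {A : Type} {E : A → A → Prop} {a b : A}
    (h : b ∈ communicatingClass E a) : b ∈ communicatingClass E b :=
  ⟨h.2.trans h.1, h.2.trans h.1⟩

/-- Two letters of a communicating class are joined by a path inside the class. -/
theorem transGen_within_communicatingClass {A : Type} {E : A → A → Prop} {a b c : A}
    (hb : b ∈ communicatingClass E a) (hc : c ∈ communicatingClass E a) :
    Relation.TransGen (fun x y => E x y ∧ x ∈ communicatingClass E a ∧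
      y ∈ communicatingClass E a) b c := by
  -- The return path from `d` to `c` is carried through the induction, because it puts every
  -- intermediate letter on a cycle through `a`.
  have key : ∀ d, Relation.TransGen E b d → Relation.TransGen E d c →
      Relation.TransGen (fun x y => E x y ∧ x ∈ communicatingClass E a ∧
        y ∈ communicatingClass E a) b d := by
    intro d hbd
    induction hbd with
    | single h => exact fun hd => .single ⟨h, hb, ⟨hb.1.tail h, hd.trans hc.2⟩⟩
    | @tail d e hbd hde ih =>
      intro hec
      have hdc := (Relation.TransGen.single hde).trans hec
      exact (ih hdc).tail ⟨hde, ⟨hb.1.trans hbd, hdc.trans hc.2⟩,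
        ⟨(hb.1.trans hbd).tail hde, hec.trans hc.2⟩⟩
  have hbc := hb.2.trans hc.1
  have hcc := hc.2.trans hc.1
  exact key c hbc hcc

open scoped Classical in
/-- A communicating class carries a positive eigenvector of its adjacency matrix. -/
theorem exists_perron_of_communicatingClass {A : Type} [Fintype A] (E : A → A → Prop) (a : A)
    (ha : a ∈ communicatingClass E a) :
    ∃ t : ℝ, 0 < t ∧ ∃ r : A → ℝ, (∀ b ∈ communicatingClass E a, 0 < r b) ∧
      ∀ b ∈ communicatingClass E a,
        ∑ c, (if c ∈ communicatingClass E a ∧ E b c then r c else 0) = t * r b := by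
  set S := communicatingClass E a with hS
  let M : Matrix S S ℝ := fun b c => if E b c then 1 else 0
  have hM : ∀ b c, 0 ≤ M b c := fun b c => by simp only [M]; split_ifs <;> norm_num
  have : Nonempty S := ⟨⟨a, ha⟩⟩
  have hirr : ∀ b c : S, ∃ k, 0 < (M ^ k) b c := by
    intro b c
    have h := transGen_within_communicatingClass (E := E) b.2 c.2
    suffices ∀ d, Relation.TransGen (fun x y => E x y ∧ x ∈ S ∧ y ∈ S) b d →
        ∀ hd : d ∈ S, ∃ k, 0 < (M ^ k) b ⟨d, hd⟩ from this c h c.2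
    intro d hbd
    induction hbd with
    | single h => exact fun hd => ⟨1, by rw [pow_one]; simp [M, h.1]⟩
    | tail _ h ih =>
      intro hd
      obtain ⟨k, hk⟩ := ih h.2.1
      refine ⟨k + 1, ?_⟩
      rw [pow_succ, Matrix.mul_apply]
      exact Finset.sum_pos' (fun e _ => mul_nonneg (Matrix.pow_apply_nonneg hM _ _ _) (hM _ _))
        ⟨⟨_, h.2.1⟩, Finset.mem_univ _, mul_pos hk (by simp [M, h.1])⟩
  have hcol : ∀ c : S, ∃ b, 0 < M b c := by
    intro c
    have h := transGen_within_communicatingClass (E := E) c.2 c.2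
    obtain ⟨d, -, hd⟩ := Relation.TransGen.tail'_iff.1 h
    exact ⟨⟨d, hd.2.1⟩, by simp [M, hd.1]⟩
  obtain ⟨t, ht, x, hx, hMx⟩ := Matrix.exists_pos_eigenvector M hM hirr hcol
  refine ⟨t, ht, fun b => if hb : b ∈ S then x ⟨b, hb⟩ else 0, fun b hb => by simp [hb, hx],
    fun b hb => ?_⟩
  have h := congrFun hMx ⟨b, hb⟩
  simp only [Matrix.mulVec, dotProduct, Pi.smul_apply, smul_eq_mul, M] at h
  simp only [hb, dif_pos]
  rw [← h, ← Fintype.sum_subtype_add_sum_subtype (fun c => c ∈ S)]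
  have h0 : ∀ c : {c // c ∉ S},
      (if (c : A) ∈ S ∧ E b c then (if hc : (c : A) ∈ S then x ⟨c, hc⟩ else 0) else 0) = 0 :=
    fun c => if_neg fun hc => c.2 hc.1
  rw [Finset.sum_congr rfl fun c _ => h0 c, Finset.sum_const_zero, add_zero]
  refine Finset.sum_congr rfl fun c _ => ?_
  have hc : (c : A) ∈ S := c.2
  simp [hc]

/-! ### Gibbs' inequality -/

/-- The conditional form of Gibbs' inequality. -/
theorem sum_negMulLog_sub_le {W B : Type*} [Fintype W] [Fintype B] (q R : W → B → ℝ)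
    (hq : ∀ w b, 0 ≤ q w b) (hR : ∀ w b, 0 ≤ R w b) (hR1 : ∀ w, ∑ b, R w b ≤ 1)
    (hqR : ∀ w b, 0 < q w b → 0 < R w b) :
    (∑ w, ∑ b, Real.negMulLog (q w b) - ∑ w, Real.negMulLog (∑ b, q w b) ≤
        ∑ w, ∑ b, q w b * -Real.log (R w b)) ∧
      (∑ w, ∑ b, q w b * -Real.log (R w b) ≤
          ∑ w, ∑ b, Real.negMulLog (q w b) - ∑ w, Real.negMulLog (∑ b, q w b) →
        ∀ w b, q w b = (∑ b, q w b) * R w b) := by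
  set m : W → ℝ := fun w => ∑ b, q w b with hm
  have hm0 : ∀ w, 0 ≤ m w := fun w => Finset.sum_nonneg fun b _ => hq w b
  -- The pointwise gap: where `q > 0` it equals `q * (u - 1 - log u)` with `u = m R / q`, hence is
  -- nonnegative and vanishes only for `u = 1`. In total it is the gap in the inequality minus the
  -- nonnegative loss `∑ m (1 - ∑ R)` due to rows of sum below one.
  let D : W → B → ℝ := fun w b =>
    q w b * -Real.log (R w b) - (Real.negMulLog (q w b) + q w b * Real.log (m w)) -
      (q w b - m w * R w b)
  have hD : ∀ w b, 0 ≤ D w b ∧ (D w b = 0 → q w b = m w * R w b) := by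
    intro w b
    rcases (hq w b).eq_or_lt with h0 | hpos
    · have : D w b = m w * R w b := by simp [D, ← h0, Real.negMulLog]
      rw [this, ← h0]
      exact ⟨mul_nonneg (hm0 w) (hR w b), fun h => h.symm⟩
    · have hRp := hqR w b hpos
      have hmp : 0 < m w := hpos.trans_le
        (Finset.single_le_sum (fun i _ => hq w i) (Finset.mem_univ b))
      set u := m w * R w b / q w b with hu
      have hup : 0 < u := by positivity
      have hlog : Real.log u = Real.log (m w) + Real.log (R w b) - Real.log (q w b) := by
        rw [hu, Real.log_div (by positivity) hpos.ne', Real.log_mul hmp.ne' hRp.ne']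
      have hqu : q w b * u = m w * R w b := by rw [hu]; field_simp
      have hDe : D w b = q w b * (u - 1 - Real.log u) := by
        simp only [D, Real.negMulLog]
        rw [hlog, ← hqu]
        ring
      rw [hDe]
      refine ⟨mul_nonneg hpos.le (by linarith [Real.log_le_sub_one_of_pos hup]), fun h => ?_⟩
      rcases mul_eq_zero.1 h with h | h
      · exact absurd h hpos.ne'
      · have : u = 1 := by
          by_contra hne
          linarith [Real.log_lt_sub_one_of_pos hup hne]
        rw [← hqu, this, mul_one]
  have hsum : ∑ w, ∑ b, D w b = ∑ w, ∑ b, q w b * -Real.log (R w b) -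
      (∑ w, ∑ b, Real.negMulLog (q w b) - ∑ w, Real.negMulLog (m w)) -
      ∑ w, m w * (1 - ∑ b, R w b) := by
    simp only [D, Finset.sum_sub_distrib, Finset.sum_add_distrib, mul_sub, mul_one,
      Finset.mul_sum, ← Finset.sum_mul, ← hm]
    have : ∑ w, Real.negMulLog (m w) = - ∑ w, m w * Real.log (m w) := by
      simp [Real.negMulLog]
    rw [this]
    simp only [hm]
    ring
  have hsub : 0 ≤ ∑ w, m w * (1 - ∑ b, R w b) :=
    Finset.sum_nonneg fun w _ => mul_nonneg (hm0 w) (by linarith [hR1 w])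
  have hDs : 0 ≤ ∑ w, ∑ b, D w b :=
    Finset.sum_nonneg fun w _ => Finset.sum_nonneg fun b _ => (hD w b).1
  refine ⟨by linarith, fun hle w b => (hD w b).2 ?_⟩
  have h0 : ∑ w, ∑ b, D w b = 0 := by linarith
  rw [Finset.sum_eq_zero_iff_of_nonneg
    (fun w _ => Finset.sum_nonneg fun b _ => (hD w b).1)] at h0
  exact (Finset.sum_eq_zero_iff_of_nonneg (fun b _ => (hD w b).1)).1 (h0 w (Finset.mem_univ w)) b
    (Finset.mem_univ b)

theorem sum_eq_sum_snoc {A M : Type*} [Fintype A] [AddCommMonoid M] {n : ℕ}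
    (f : (Fin (n + 1) → A) → M) : ∑ w, f w = ∑ w, ∑ b, f (Fin.snoc w b) := by
  rw [← (Fin.snocEquiv fun _ : Fin (n + 1) => A).sum_comp, Fintype.sum_prod_type,
    Finset.sum_comm]
  rfl

theorem sum_eq_sum_cons {A M : Type*} [Fintype A] [AddCommMonoid M] {n : ℕ}
    (f : (Fin (n + 1) → A) → M) : ∑ w, f w = ∑ w, ∑ a, f (Fin.cons a w) := by
  rw [← (Fin.consEquiv fun _ : Fin (n + 1) => A).sum_comp, Fintype.sum_prod_type,
    Finset.sum_comm]
  rfl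

/-! ### Stationary processes and their entropy rate -/

/-- The family of the laws of the blocks of a stationary process with values in `A`. -/
structure StationaryLaw (A : Type) [Fintype A] where
  /-- The probability of a block. -/
  prob : (n : ℕ) → (Fin n → A) → ℝ
  nonneg : ∀ n w, 0 ≤ prob n w
  prob_zero : ∀ w, prob 0 w = 1
  sum_snoc : ∀ n w, ∑ b, prob (n + 1) (Fin.snoc w b) = prob n w
  sum_cons : ∀ n w, ∑ a, prob (n + 1) (Fin.cons a w) = prob n w

namespace StationaryLaw

variable {A : Type} [Fintype A] (p : StationaryLaw A)

/-- The entropy of the blocks of length `n`. -/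
noncomputable def blockEntropy (n : ℕ) : ℝ := ∑ w, Real.negMulLog (p.prob n w)

/-- The entropy of a letter, conditionally on the `n` letters before it. -/
noncomputable def condEntropy (n : ℕ) : ℝ := p.blockEntropy (n + 1) - p.blockEntropy n

/-- This is the left side of `sum_negMulLog_sub_le`, with the past block as `w` and the next letter
as `b`. -/
theorem condEntropy_eq (n : ℕ) :
    p.condEntropy n = ∑ w, ∑ b, Real.negMulLog (p.prob (n + 1) (Fin.snoc w b)) -
      ∑ w, Real.negMulLog (∑ b, p.prob (n + 1) (Fin.snoc w b)) := by
  simp only [condEntropy, blockEntropy, p.sum_snoc]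
  rw [sum_eq_sum_snoc]

theorem prob_snoc_le (n : ℕ) (w : Fin n → A) (b : A) :
    p.prob (n + 1) (Fin.snoc w b) ≤ p.prob n w := by
  rw [← p.sum_snoc n w]
  exact Finset.single_le_sum (f := fun b => p.prob (n + 1) (Fin.snoc w b))
    (fun i _ => p.nonneg _ _) (Finset.mem_univ b)

theorem prob_cons_le (n : ℕ) (w : Fin n → A) (a : A) :
    p.prob (n + 1) (Fin.cons a w) ≤ p.prob n w := by
  rw [← p.sum_cons n w]
  exact Finset.single_le_sum (f := fun a => p.prob (n + 1) (Fin.cons a w))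
    (fun i _ => p.nonneg _ _) (Finset.mem_univ a)

theorem condEntropy_eq_sum_log (n : ℕ) :
    p.condEntropy n = ∑ w, ∑ b, p.prob (n + 1) (Fin.snoc w b) *
      -Real.log (p.prob (n + 1) (Fin.snoc w b) / p.prob n w) := by
  rw [condEntropy_eq, ← Finset.sum_sub_distrib]
  refine Finset.sum_congr rfl fun w _ => ?_
  rw [Real.negMulLog, ← neg_mul_eq_neg_mul, Finset.sum_mul, sub_neg_eq_add,
    ← Finset.sum_add_distrib]
  refine Finset.sum_congr rfl fun b _ => ?_
  rw [p.sum_snoc]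
  rcases (p.nonneg (n + 1) (Fin.snoc w b)).eq_or_lt with h | h
  · simp [← h]
  · rw [Real.log_div h.ne' (h.trans_le (p.prob_snoc_le n w b)).ne', Real.negMulLog]
    ring

theorem condEntropy_nonneg (n : ℕ) : 0 ≤ p.condEntropy n := by
  rw [condEntropy_eq_sum_log]
  refine Finset.sum_nonneg fun w _ => Finset.sum_nonneg fun b _ =>
    mul_nonneg (p.nonneg _ _) (neg_nonneg.2 (Real.log_nonpos ?_ ?_))
  · exact div_nonneg (p.nonneg _ _) (p.nonneg _ _)
  · exact div_le_one_of_le₀ (p.prob_snoc_le n w b) (p.nonneg _ _)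

/-- Conditioning on a longer past lowers the entropy: Gibbs' inequality is applied with `R` the
conditional law given the past without its oldest letter. Summing out that letter turns the right
side into the previous conditional entropy. -/
theorem condEntropy_antitone : Antitone p.condEntropy := by
  refine antitone_nat_of_succ_le fun n => ?_
  rw [condEntropy_eq p (n + 1), condEntropy_eq_sum_log p n]
  refine (sum_negMulLog_sub_le (fun w b => p.prob (n + 2) (Fin.snoc w b))
    (fun w b => p.prob (n + 1) (Fin.snoc (Fin.tail w) b) / p.prob n (Fin.tail w))
    (fun w b => p.nonneg _ _) (fun w b => div_nonneg (p.nonneg _ _) (p.nonneg _ _))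
    (fun w => ?_) (fun w b h => ?_)).1.trans_eq ?_
  · rw [← Finset.sum_div, p.sum_snoc]
    exact div_self_le_one _
  · have h1 : 0 < p.prob (n + 1) (Fin.snoc (Fin.tail w) b) := by
      refine h.trans_le ?_
      have := p.prob_cons_le (n + 1) (Fin.snoc (Fin.tail w) b) (w 0)
      rwa [Fin.cons_snoc_eq_snoc_cons, Fin.cons_self_tail] at this
    exact div_pos h1 (h1.trans_le (p.prob_snoc_le _ _ _))
  · rw [sum_eq_sum_cons]
    refine Finset.sum_congr rfl fun u _ => ?_
    rw [Finset.sum_comm]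
    refine Finset.sum_congr rfl fun b _ => ?_
    simp only [Fin.tail_cons]
    rw [← Finset.sum_mul]
    congr 1
    rw [← p.sum_cons]
    refine Finset.sum_congr rfl fun a _ => ?_
    rw [Fin.cons_snoc_eq_snoc_cons]

theorem blockEntropy_eq_sum (n : ℕ) :
    p.blockEntropy n = ∑ k ∈ Finset.range n, p.condEntropy k := by
  simp only [condEntropy]
  rw [Finset.sum_range_sub, blockEntropy, blockEntropy]
  simp [p.prob_zero]

/-- The entropy rate of the process. -/
noncomputable def entropyRate : ℝ := ⨅ n, p.condEntropy n

theorem bddBelow_condEntropy : BddBelow (Set.range p.condEntropy) :=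
  ⟨0, by rintro _ ⟨n, rfl⟩; exact p.condEntropy_nonneg n⟩

theorem entropyRate_le (n : ℕ) : p.entropyRate ≤ p.condEntropy n :=
  ciInf_le p.bddBelow_condEntropy n

/-- Block entropies are partial sums of the conditional entropies, which decrease to their infimum;
their Cesàro means have the same limit. -/
theorem tendsto_blockEntropy_div :
    Tendsto (fun n : ℕ => p.blockEntropy n / n) atTop (nhds p.entropyRate) := by
  have h := (tendsto_atTop_ciInf p.condEntropy_antitone p.bddBelow_condEntropy).cesaro
  refine h.congr fun n => ?_
  rw [p.blockEntropy_eq_sum, div_eq_inv_mul]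

end StationaryLaw

/-! ### Perron data of the whole graph and Parry's kernel -/

open scoped Classical in
/-- `r` is on each communicating class of the graph of `E` a positive eigenvector of the adjacency
matrix of the class, and `lam` is the corresponding eigenvalue. -/
structure IsPerronData {A : Type} [Fintype A] (E : A → A → Prop) (lam r : A → ℝ) : Prop where
  lam_eq : ∀ a b, b ∈ communicatingClass E a → lam b = lam a
  lam_pos : ∀ a, a ∈ communicatingClass E a → 0 < lam a
  vec_pos : ∀ a, a ∈ communicatingClass E a → 0 < r a
  sum_eq : ∀ a, a ∈ communicatingClass E a →
    ∑ c, (if c ∈ communicatingClass E a ∧ E a c then r c else 0) = lam a * r a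

theorem exists_isPerronData {A : Type} [Fintype A] (E : A → A → Prop) :
    ∃ lam r : A → ℝ, IsPerronData E lam r := by
  classical
  -- The choice is made for each set of letters, not for each letter, so that communicating letters
  -- share one eigenvalue and one eigenvector.
  have h : ∀ S : Set A, ∃ t : ℝ, ∃ r : A → ℝ, ∀ a, a ∈ communicatingClass E a →
      S = communicatingClass E a → 0 < t ∧ (∀ b ∈ S, 0 < r b) ∧
        ∀ b ∈ S, ∑ c, (if c ∈ S ∧ E b c then r c else 0) = t * r b := by
    intro S
    by_cases hS : ∃ a, a ∈ communicatingClass E a ∧ S = communicatingClass E a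
    · obtain ⟨a, ha, rfl⟩ := hS
      obtain ⟨t, ht, r, hr, hs⟩ := exists_perron_of_communicatingClass E a ha
      exact ⟨t, r, fun _ _ _ => ⟨ht, hr, fun b hb => by convert hs b hb⟩⟩
    · exact ⟨0, 0, fun a ha haS => absurd ⟨a, ha, haS⟩ hS⟩
  choose t r h using h
  refine ⟨fun a => t (communicatingClass E a), fun a => r (communicatingClass E a) a, ?_, ?_, ?_, ?_⟩
  · intro a b hb
    simp only [communicatingClass_eq_of_mem hb]
  · exact fun a ha => (h _ a ha rfl).1
  · exact fun a ha => (h _ a ha rfl).2.1 a ha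
  · intro a ha
    rw [← (h _ a ha rfl).2.2 a ha]
    refine Finset.sum_congr rfl fun c _ => ?_
    by_cases hc : c ∈ communicatingClass E a
    · simp only [communicatingClass_eq_of_mem hc]
    · simp [hc]

open scoped Classical in
/-- The transition matrix of the Markov chain of maximal entropy on each communicating class. -/
noncomputable def parryMatrix {A : Type} (E : A → A → Prop) (lam r : A → ℝ) (a b : A) : ℝ :=
  if b ∈ communicatingClass E a ∧ E a b then r b / (lam a * r a) else 0

namespace IsPerronData

variable {A : Type} [Fintype A] {E : A → A → Prop} {lam r : A → ℝ}

theorem parryMatrix_pos (h : IsPerronData E lam r) {a b : A} (hb : b ∈ communicatingClass E a)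
    (hE : E a b) : 0 < parryMatrix E lam r a b := by
  have hbb := self_mem_of_mem_communicatingClass hb
  have haa := self_mem_of_mem_communicatingClass (mem_communicatingClass_comm.1 hb)
  rw [parryMatrix, if_pos ⟨hb, hE⟩]
  exact div_pos (h.vec_pos b hbb) (mul_pos (h.lam_pos a haa) (h.vec_pos a haa))

theorem parryMatrix_nonneg (h : IsPerronData E lam r) (a b : A) :
    0 ≤ parryMatrix E lam r a b := by
  by_cases hab : b ∈ communicatingClass E a ∧ E a b
  · exact (h.parryMatrix_pos hab.1 hab.2).le
  · rw [parryMatrix, if_neg hab]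

/-- The eigenvector equation gives sum `1` for a letter that communicates with itself; the row of
any other letter is zero. -/
theorem sum_parryMatrix_le_one (h : IsPerronData E lam r) (a : A) :
    ∑ b, parryMatrix E lam r a b ≤ 1 := by
  classical
  by_cases ha : a ∈ communicatingClass E a
  · have hpos := mul_pos (h.lam_pos a ha) (h.vec_pos a ha)
    have : ∀ b, parryMatrix E lam r a b =
        (if b ∈ communicatingClass E a ∧ E a b then r b else 0) / (lam a * r a) := by
      intro b
      rw [parryMatrix, ite_div, zero_div]
    rw [Finset.sum_congr rfl fun b _ => this b, ← Finset.sum_div, div_le_one hpos]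
    exact (le_of_eq (by rw [← h.sum_eq a ha]))
  · refine (Finset.sum_nonpos fun b _ => ?_).trans zero_le_one
    rw [parryMatrix, if_neg]
    exact fun hb => ha (self_mem_of_mem_communicatingClass (mem_communicatingClass_comm.1 hb.1))

theorem neg_log_parryMatrix (h : IsPerronData E lam r) {a b : A}
    (hb : b ∈ communicatingClass E a) (hE : E a b) :
    -Real.log (parryMatrix E lam r a b) = Real.log (lam a) + Real.log (r a) - Real.log (r b) := by
  have hbb := self_mem_of_mem_communicatingClass hb
  have haa := self_mem_of_mem_communicatingClass (mem_communicatingClass_comm.1 hb)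
  have h1 := h.vec_pos b hbb
  have h2 := h.lam_pos a haa
  have h3 := h.vec_pos a haa
  rw [parryMatrix, if_pos ⟨hb, hE⟩, Real.log_div h1.ne' (mul_pos h2 h3).ne',
    Real.log_mul h2.ne' h3.ne']
  ring

/-- The eigenvalue of a communicating class is at most the number of its letters. -/
theorem lam_le_ncard (h : IsPerronData E lam r) {a : A} (ha : a ∈ communicatingClass E a) :
    lam a ≤ (communicatingClass E a).ncard := by
  classical
  set S := communicatingClass E a with hS
  -- At a letter where `r` is largest, the eigenvector equation bounds `lam * r b` by the size of
  -- the class times `r b`.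
  obtain ⟨b, hbS, hb⟩ := S.toFinset.exists_max_image r ⟨a, by simpa using ha⟩
  have hbS : b ∈ S := by simpa using hbS
  have hbb := self_mem_of_mem_communicatingClass hbS
  have hrb := h.vec_pos b hbb
  have hs := h.sum_eq b hbb
  rw [communicatingClass_eq_of_mem hbS, h.lam_eq a b hbS, ← hS] at hs
  refine le_of_mul_le_mul_right ?_ hrb
  calc lam a * r b = ∑ c, (if c ∈ S ∧ E b c then r c else 0) := by rw [← hs]
    _ ≤ ∑ c, (if c ∈ S then r b else 0) := by
        refine Finset.sum_le_sum fun c _ => ?_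
        by_cases hc : c ∈ S
        · by_cases hE : E b c
          · simp only [hc, hE, and_self, if_true]
            exact hb c (by simpa using hc)
          · simp [hc, hE, hrb.le]
        · simp [hc]
    _ = S.ncard * r b := by
        rw [← Finset.sum_filter, Finset.sum_const, nsmul_eq_mul, Set.ncard_eq_toFinset_card']
        congr 3
        ext c
        simp

end IsPerronData

/-! ### The entropy bound and its equality case -/

namespace StationaryLaw

variable {A : Type} [Fintype A] (p : StationaryLaw A)

/-- The law of a letter. -/
def letter (a : A) : ℝ := p.prob 1 fun _ => a

/-- The law of two consecutive letters. -/
def pair (a b : A) : ℝ := p.prob 2 (Fin.snoc (fun _ : Fin 1 => a) b)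

theorem pair_nonneg (a b : A) : 0 ≤ p.pair a b := p.nonneg _ _

theorem letter_nonneg (a : A) : 0 ≤ p.letter a := p.nonneg _ _

theorem sum_pair_right (a : A) : ∑ b, p.pair a b = p.letter a := p.sum_snoc 1 _

theorem sum_pair_left (b : A) : ∑ a, p.pair a b = p.letter b := by
  rw [letter, ← p.sum_cons]
  refine Finset.sum_congr rfl fun a _ => ?_
  rw [pair]
  congr 1
  ext i
  fin_cases i <;> rfl

theorem sum_letter : ∑ a, p.letter a = 1 := by
  rw [← p.prob_zero (fun i => i.elim0), ← p.sum_cons]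
  refine Finset.sum_congr rfl fun a _ => ?_
  rw [letter]
  congr 1
  ext i
  fin_cases i
  rfl

/-- The last two letters of a block have the law of any two consecutive letters. -/
theorem sum_prob_snoc_mul (n : ℕ) (g : A → A → ℝ) :
    ∑ w : Fin (n + 1) → A, ∑ b, p.prob (n + 2) (Fin.snoc w b) * g (w (Fin.last n)) b =
      ∑ a, ∑ b, p.pair a b * g a b := by
  induction n with
  | zero =>
    rw [← (Equiv.funUnique (Fin 1) A).symm.sum_comp]
    rfl
  | succ n ih =>
    rw [← ih, sum_eq_sum_cons]
    refine Finset.sum_congr rfl fun u _ => ?_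
    rw [Finset.sum_comm]
    refine Finset.sum_congr rfl fun b _ => ?_
    have : ∀ a, (Fin.cons a u : Fin (n + 2) → A) (Fin.last (n + 1)) = u (Fin.last n) := fun a => by
      rw [← Fin.succ_last, Fin.cons_succ]
    simp only [this]
    rw [← Finset.sum_mul, ← p.sum_cons]
    simp only [Fin.cons_snoc_eq_snoc_cons]

/-- Taking for `g` the indicator of one pair in `sum_prob_snoc_mul` transfers the support condition
from pairs to long blocks, as the positivity hypothesis of Gibbs' inequality requires. -/
theorem pair_pos_of_prob_pos {n : ℕ} {w : Fin (n + 1) → A} {b : A}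
    (h : 0 < p.prob (n + 2) (Fin.snoc w b)) : 0 < p.pair (w (Fin.last n)) b := by
  classical
  have h1 := p.sum_prob_snoc_mul n fun c d => if c = w (Fin.last n) ∧ d = b then 1 else 0
  have h2 : ∑ c, ∑ d, p.pair c d * (if c = w (Fin.last n) ∧ d = b then (1 : ℝ) else 0) =
      p.pair (w (Fin.last n)) b := by
    rw [Finset.sum_eq_single (w (Fin.last n)), Finset.sum_eq_single b] <;> simp +contextual
  rw [← h2, ← h1]
  have hnn : ∀ (u : Fin (n + 1) → A) (d : A), 0 ≤ p.prob (n + 2) (Fin.snoc u d) *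
      (if u (Fin.last n) = w (Fin.last n) ∧ d = b then (1 : ℝ) else 0) := fun u d =>
    mul_nonneg (p.nonneg _ _) (by split_ifs <;> norm_num)
  refine Finset.sum_pos' (fun u _ => Finset.sum_nonneg fun d _ => hnn u d)
    ⟨w, Finset.mem_univ _, Finset.sum_pos' (fun d _ => hnn w d) ⟨b, Finset.mem_univ _, ?_⟩⟩
  simpa using h

variable {E : A → A → Prop}

/-- A stationary process only makes transitions inside communicating classes: there is no flow
from the complement of the set of letters that can be reached from `b` into that set. -/
theorem mem_communicatingClass_of_pair_pos (hE : ∀ a b, 0 < p.pair a b → E a b) {a b : A}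
    (hab : 0 < p.pair a b) : b ∈ communicatingClass E a := by
  classical
  let S : Finset A := Finset.univ.filter fun c => Relation.ReflTransGen E b c
  have hS : ∀ c, c ∈ S ↔ Relation.ReflTransGen E b c := fun c => by simp [S]
  have hout : ∀ c ∈ S, ∀ d ∉ S, p.pair c d = 0 := by
    intro c hc d hd
    by_contra hne
    have := hE c d (lt_of_le_of_ne (p.pair_nonneg c d) (Ne.symm hne))
    exact hd ((hS d).2 (((hS c).1 hc).tail this))
  -- The mass of `S` is counted by first letters, no pair leaving `S`, and then by second letters.
  -- The difference is the flow into `S`, which must vanish.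
  have h1 : ∑ c ∈ S, p.letter c = ∑ c ∈ S, ∑ d ∈ S, p.pair c d := by
    refine Finset.sum_congr rfl fun c hc => ?_
    rw [← p.sum_pair_right]
    exact (Finset.sum_subset (Finset.subset_univ S) fun d _ hd => hout c hc d hd).symm
  have h2 : ∑ d ∈ S, p.letter d = ∑ d ∈ S, ∑ c ∈ S, p.pair c d +
      ∑ d ∈ S, ∑ c ∈ Sᶜ, p.pair c d := by
    rw [← Finset.sum_add_distrib]
    refine Finset.sum_congr rfl fun d _ => ?_
    rw [← p.sum_pair_left, Finset.sum_add_sum_compl]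
  have h3 : ∑ d ∈ S, ∑ c ∈ Sᶜ, p.pair c d = 0 := by
    rw [Finset.sum_comm] at h1
    linarith
  have ha : a ∈ S := by
    by_contra ha
    have hb : b ∈ S := (hS b).2 .refl
    rw [Finset.sum_eq_zero_iff_of_nonneg
      (fun d _ => Finset.sum_nonneg fun c _ => p.pair_nonneg c d)] at h3
    have := (Finset.sum_eq_zero_iff_of_nonneg (fun c _ => p.pair_nonneg c b)).1 (h3 b hb) a
      (Finset.mem_compl.2 ha)
    exact hab.ne' this
  refine ⟨.single (hE a b hab), ?_⟩
  rcases Relation.reflTransGen_iff_eq_or_transGen.1 ((hS a).1 ha) with h | h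
  · exact .single (by simpa only [h] using hE a b hab)
  · exact h

theorem exists_pair_pos_of_letter_pos {a : A} (ha : 0 < p.letter a) : ∃ b, 0 < p.pair a b := by
  by_contra! h
  rw [← p.sum_pair_right] at ha
  exact absurd ha (not_lt.2 (Finset.sum_nonpos fun b _ => h b))

theorem mem_communicatingClass_of_letter_pos (hE : ∀ a b, 0 < p.pair a b → E a b) {a : A}
    (ha : 0 < p.letter a) : a ∈ communicatingClass E a := by
  obtain ⟨b, hb⟩ := p.exists_pair_pos_of_letter_pos ha
  exact self_mem_of_mem_communicatingClass
    (mem_communicatingClass_comm.1 (p.mem_communicatingClass_of_pair_pos hE hb))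

variable {lam r : A → ℝ}

/-- On an edge of positive mass, `-log` of the kernel is `log lam a + log r a - log r b`. Both
marginals of the pair law are the letter law, so the terms in `r` cancel. -/
theorem sum_pair_mul_neg_log (hE : ∀ a b, 0 < p.pair a b → E a b) (h : IsPerronData E lam r) :
    ∑ a, ∑ b, p.pair a b * -Real.log (parryMatrix E lam r a b) =
      ∑ a, p.letter a * Real.log (lam a) := by
  have h1 : ∀ a b, p.pair a b * -Real.log (parryMatrix E lam r a b) =
      p.pair a b * (Real.log (lam a) + Real.log (r a)) - p.pair a b * Real.log (r b) := by
    intro a b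
    rcases (p.pair_nonneg a b).eq_or_lt with h0 | h0
    · simp [← h0]
    · rw [h.neg_log_parryMatrix (p.mem_communicatingClass_of_pair_pos hE h0) (hE a b h0)]
      ring
  simp only [h1, Finset.sum_sub_distrib, ← Finset.sum_mul, p.sum_pair_right]
  rw [Finset.sum_comm (f := fun a b => p.pair a b * Real.log (r b))]
  simp only [← Finset.sum_mul, p.sum_pair_left, mul_add, Finset.sum_add_distrib]
  ring

/-- The entropy bound for stationary processes on a graph, with its equality case. -/
theorem condEntropy_succ_le (hE : ∀ a b, 0 < p.pair a b → E a b) (h : IsPerronData E lam r)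
    (n : ℕ) :
    p.condEntropy (n + 1) ≤ ∑ a, p.letter a * Real.log (lam a) ∧
      (∑ a, p.letter a * Real.log (lam a) ≤ p.condEntropy (n + 1) → ∀ w b,
        p.prob (n + 2) (Fin.snoc w b) =
          p.prob (n + 1) w * parryMatrix E lam r (w (Fin.last n)) b) := by
  have hg := sum_negMulLog_sub_le (fun (w : Fin (n + 1) → A) b => p.prob (n + 2) (Fin.snoc w b))
    (fun w b => parryMatrix E lam r (w (Fin.last n)) b)
    (fun w b => p.nonneg _ _) (fun w b => h.parryMatrix_nonneg _ _)
    (fun w => h.sum_parryMatrix_le_one _) (fun w b hwb => by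
      have := p.pair_pos_of_prob_pos hwb
      exact h.parryMatrix_pos (p.mem_communicatingClass_of_pair_pos hE this) (hE _ _ this))
  rw [p.sum_prob_snoc_mul n fun a b => -Real.log (parryMatrix E lam r a b),
    p.sum_pair_mul_neg_log hE h, ← p.condEntropy_eq (n + 1)] at hg
  refine ⟨hg.1, fun hle w b => ?_⟩
  rw [hg.2 hle w b, p.sum_snoc]

/-- A stationary process on a graph whose entropy is at least that of every communicating class
lives on the classes of maximal entropy, and is a Markov chain there. -/
theorem markov_of_le_entropyRate (hE : ∀ a b, 0 < p.pair a b → E a b)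
    (h : IsPerronData E lam r)
    (hmax : ∀ a, a ∈ communicatingClass E a → Real.log (lam a) ≤ p.entropyRate) :
    (∀ a, 0 < p.letter a → Real.log (lam a) = p.entropyRate) ∧
      ∀ n w b, p.prob (n + 2) (Fin.snoc w b) =
        p.prob (n + 1) w * parryMatrix E lam r (w (Fin.last n)) b := by
  have hle : ∀ a, p.letter a * Real.log (lam a) ≤ p.letter a * p.entropyRate := by
    intro a
    rcases (p.letter_nonneg a).eq_or_lt with h0 | h0
    · simp [← h0]
    · exact mul_le_mul_of_nonneg_left (hmax a (p.mem_communicatingClass_of_letter_pos hE h0)) h0.le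
  have hsum : ∑ a, p.letter a * p.entropyRate = p.entropyRate := by
    rw [← Finset.sum_mul, p.sum_letter, one_mul]
  have hle' : ∑ a, p.letter a * Real.log (lam a) ≤ p.entropyRate := by
    rw [← hsum]
    exact Finset.sum_le_sum fun a _ => hle a
  -- With `hle'`, the average of `log lam` is squeezed to the entropy rate. The latter is below
  -- every conditional entropy, so the equality case of Gibbs' inequality applies at each block
  -- length.
  have hge : p.entropyRate ≤ ∑ a, p.letter a * Real.log (lam a) :=
    (p.entropyRate_le 1).trans (p.condEntropy_succ_le hE h 0).1
  refine ⟨fun a ha => ?_, fun n =>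
    (p.condEntropy_succ_le hE h n).2 (hle'.trans (p.entropyRate_le (n + 1)))⟩
  have heq : ∑ a, p.letter a * Real.log (lam a) = ∑ a, p.letter a * p.entropyRate := by
    rw [hsum]
    exact le_antisymm hle' hge
  have := (Finset.sum_eq_sum_iff_of_le fun a _ => hle a).1 heq a (Finset.mem_univ a)
  exact mul_left_cancel₀ ha.ne' this

end StationaryLaw

/-! ### Uniqueness of the maximal process on a single class -/

/-- An irreducible stochastic matrix has at most one stationary probability vector. -/
theorem stationary_vector_unique {A : Type} [Fintype A] (P : A → A → ℝ) (hP : ∀ a b, 0 ≤ P a b)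
    (S : Set A)
    (hS : ∀ a ∈ S, ∀ b ∈ S, Relation.ReflTransGen (fun x y => 0 < P x y) a b) (u v : A → ℝ)
    (hu : ∀ a, 0 ≤ u a) (hu1 : ∑ a, u a = 1) (hv1 : ∑ a, v a = 1)
    (huS : ∀ a ∉ S, u a = 0) (hvS : ∀ a ∉ S, v a = 0)
    (huP : ∀ b, ∑ a, u a * P a b = u b) (hvP : ∀ b, ∑ a, v a * P a b = v b) : u = v := by
  classical
  have hpos : ∀ q : A → ℝ, (∀ a, 0 ≤ q a) → (∀ b, ∑ a, q a * P a b = q b) → ∀ a ∈ S, 0 < q a →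
      ∀ b ∈ S, 0 < q b := by
    intro q hq hqP a ha hqa b hb
    have h := hS a ha b hb
    clear hb
    induction h with
    | refl => exact hqa
    | @tail c d _ hcd ih =>
      rw [← hqP]
      exact Finset.sum_pos' (fun e _ => mul_nonneg (hq e) (hP e d))
        ⟨c, Finset.mem_univ c, mul_pos ih hcd⟩
  obtain ⟨a₀, ha₀⟩ : ∃ a, 0 < u a := by
    by_contra! h
    have := Finset.sum_nonpos fun a (_ : a ∈ Finset.univ) => h a
    linarith
  have ha₀S : a₀ ∈ S := by
    by_contra h
    exact ha₀.ne' (huS a₀ h)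
  have huS' := hpos u hu huP a₀ ha₀S ha₀
  obtain ⟨c, hcS, hc⟩ := S.toFinset.exists_min_image (fun a => v a / u a)
    ⟨a₀, by simpa using ha₀S⟩
  have hcS : c ∈ S := by simpa using hcS
  -- The minimal ratio makes `v - t u` a nonnegative stationary vector that vanishes at `c`. By
  -- irreducibility it vanishes on `S`, since positivity anywhere in `S` would spread to `c`.
  set t := v c / u c with ht
  have hq : ∀ a, 0 ≤ v a - t * u a := by
    intro a
    by_cases ha : a ∈ S
    · have := hc a (by simpa using ha)
      rw [le_div_iff₀ (huS' a ha)] at this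
      linarith
    · simp [huS a ha, hvS a ha]
  have hqP : ∀ b, ∑ a, (v a - t * u a) * P a b = v b - t * u b := by
    intro b
    simp only [sub_mul, Finset.sum_sub_distrib, mul_assoc, ← Finset.mul_sum, huP, hvP]
  have hqc : v c - t * u c = 0 := by
    rw [ht, div_mul_cancel₀ _ (huS' c hcS).ne', sub_self]
  have hzero : ∀ a, v a = t * u a := by
    intro a
    by_cases ha : a ∈ S
    · by_contra hne
      have := hpos (fun a => v a - t * u a) hq hqP a ha
        (lt_of_le_of_ne (hq a) (Ne.symm (sub_ne_zero.2 hne))) c hcS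
      exact this.ne' hqc
    · simp [huS a ha, hvS a ha]
  have ht1 : t = 1 := by
    have : ∑ a, v a = t * ∑ a, u a := by
      rw [Finset.mul_sum]
      exact Finset.sum_congr rfl fun a _ => hzero a
    rw [hu1, hv1, mul_one] at this
    exact this.symm
  ext a
  rw [hzero a, ht1, one_mul]

/-- On a graph with only one communicating class of maximal entropy, a stationary process of
maximal entropy is unique. -/
theorem StationaryLaw.prob_eq_of_unique_class {A : Type} [Fintype A] (p q : StationaryLaw A)
    {E : A → A → Prop} {lam r : A → ℝ} (h : IsPerronData E lam r)
    (hpE : ∀ a b, 0 < p.pair a b → E a b) (hqE : ∀ a b, 0 < q.pair a b → E a b)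
    (hpq : p.entropyRate = q.entropyRate)
    (hmax : ∀ a, a ∈ communicatingClass E a → Real.log (lam a) ≤ p.entropyRate) (c : A)
    (huniq : ∀ a, a ∈ communicatingClass E a → Real.log (lam a) = p.entropyRate →
      a ∈ communicatingClass E c) (n : ℕ) (w : Fin n → A) : p.prob n w = q.prob n w := by
  obtain ⟨hp1, hp2⟩ := p.markov_of_le_entropyRate hpE h hmax
  obtain ⟨hq1, hq2⟩ := q.markov_of_le_entropyRate hqE h (hpq ▸ hmax)
  have hstat : ∀ s : StationaryLaw A, (∀ n w b, s.prob (n + 2) (Fin.snoc w b) =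
      s.prob (n + 1) w * parryMatrix E lam r (w (Fin.last n)) b) →
      ∀ b, ∑ a, s.letter a * parryMatrix E lam r a b = s.letter b := by
    intro s hs b
    rw [← s.sum_pair_left]
    exact Finset.sum_congr rfl fun a _ => (hs 0 (fun _ => a) b).symm
  have hletter : p.letter = q.letter := by
    refine stationary_vector_unique (parryMatrix E lam r) h.parryMatrix_nonneg
      (communicatingClass E c) ?_ _ _ p.letter_nonneg p.sum_letter q.sum_letter
      ?_ ?_ (hstat p hp2) (hstat q hq2)
    · intro a ha b hb
      refine Relation.TransGen.to_reflTransGen (Relation.TransGen.mono (fun x y hxy => ?_) a b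
        (transGen_within_communicatingClass ha hb))
      obtain ⟨hxy, hx, hy⟩ := hxy
      exact h.parryMatrix_pos (communicatingClass_eq_of_mem hx ▸ hy) hxy
    · intro a ha
      by_contra hne
      have hpos := lt_of_le_of_ne (p.letter_nonneg a) (Ne.symm hne)
      exact ha (huniq a (p.mem_communicatingClass_of_letter_pos hpE hpos) (hp1 a hpos))
    · intro a ha
      by_contra hne
      have hpos := lt_of_le_of_ne (q.letter_nonneg a) (Ne.symm hne)
      exact ha (huniq a (q.mem_communicatingClass_of_letter_pos hqE hpos)
        ((hq1 a hpos).trans hpq.symm))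
  -- The letter law starts the induction and the common Markov rule extends blocks by one letter.
  match n, w with
  | 0, w => rw [p.prob_zero, q.prob_zero]
  | n + 1, w =>
    induction n with
    | zero =>
      have hw : w = fun _ => w 0 := by
        ext i
        rw [Subsingleton.elim (α := Fin 1) i 0]
      rw [hw]
      exact congrFun hletter (w 0)
    | succ n ih => rw [← Fin.snoc_init_self w, hp2, hq2, ih]

/-! ### Extending and counting paths inside a class -/

/-- A function on the natural numbers that agrees with a finite path and continues it. -/
theorem exists_nat_path_extending {A : Type} (G : A → A → Prop) (S : Set A)
    (hS : ∀ a ∈ S, ∃ b ∈ S, G a b) {n : ℕ} (w : Fin (n + 1) → A) (hwS : ∀ i, w i ∈ S)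
    (hw : ∀ i : Fin n, G (w i.castSucc) (w i.succ)) :
    ∃ u : ℕ → A, (∀ k, u k ∈ S ∧ G (u k) (u (k + 1))) ∧ ∀ i : Fin (n + 1), u i = w i := by
  classical
  have : ∀ a, ∃ b, a ∈ S → b ∈ S ∧ G a b := fun a => by
    by_cases ha : a ∈ S
    · obtain ⟨b, hb⟩ := hS a ha
      exact ⟨b, fun _ => hb⟩
    · exact ⟨a, fun h => absurd h ha⟩
  choose f hf using this
  let u : ℕ → A := fun k => Nat.rec (w 0)
    (fun k a => if h : k + 1 < n + 1 then w ⟨k + 1, h⟩ else f a) k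
  have hu : ∀ k, u (k + 1) = if h : k + 1 < n + 1 then w ⟨k + 1, h⟩ else f (u k) := fun _ => rfl
  have hw' : ∀ k (h : k < n + 1), u k = w ⟨k, h⟩ := by
    intro k h
    cases k with
    | zero => rfl
    | succ k => rw [hu, dif_pos h]
  have hmem : ∀ k, u k ∈ S := by
    intro k
    induction k with
    | zero => exact hwS 0
    | succ k ih =>
      rw [hu]
      split_ifs
      · exact hwS _
      · exact (hf _ ih).1
  refine ⟨u, fun k => ⟨hmem k, ?_⟩, fun i => hw' i i.2⟩
  rw [hu]
  split_ifs with h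
  · rw [hw' k (by omega)]
    exact hw ⟨k, by omega⟩
  · exact (hf _ (hmem k)).2

/-- A two-sided sequence that agrees with a one-sided path and continues it to the left. -/
theorem exists_int_path_extending {A : Type} (G : A → A → Prop) (S : Set A)
    (hS : ∀ b ∈ S, ∃ a ∈ S, G a b) (u : ℕ → A) (hu : ∀ k, u k ∈ S ∧ G (u k) (u (k + 1))) :
    ∃ z : ℤ → A, (∀ v, z v ∈ S ∧ G (z v) (z (v + 1))) ∧ ∀ k : ℕ, z k = u k := by
  classical
  have : ∀ b, ∃ a, b ∈ S → a ∈ S ∧ G a b := fun b => by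
    by_cases hb : b ∈ S
    · obtain ⟨a, ha⟩ := hS b hb
      exact ⟨a, fun _ => ha⟩
    · exact ⟨b, fun h => absurd h hb⟩
  choose g hg using this
  let y : ℕ → A := fun k => g^[k] (u 0)
  have hy : ∀ k, y (k + 1) = g (y k) := fun k => Function.iterate_succ_apply' g k (u 0)
  have hyS : ∀ k, y k ∈ S := by
    intro k
    induction k with
    | zero => exact (hu 0).1
    | succ k ih => rw [hy]; exact (hg _ ih).1
  have hyG : ∀ k, G (y (k + 1)) (y k) := fun k => by rw [hy]; exact (hg _ (hyS k)).2
  let z : ℤ → A := fun v => if 0 ≤ v then u v.toNat else y (-v).toNat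
  have hzu : ∀ k : ℕ, z k = u k := fun k => by simp [z]
  have hzy : ∀ k : ℕ, z (-(k : ℤ)) = y k := fun k => by
    cases k with
    | zero => simp [z, y]
    | succ k =>
      have : ¬ (0 : ℤ) ≤ -((k + 1 : ℕ) : ℤ) := by omega
      simp only [z, if_neg this, neg_neg, Int.toNat_natCast]
  refine ⟨z, fun v => ?_, hzu⟩
  rcases le_or_gt 0 v with hv | hv
  · obtain ⟨k, rfl⟩ := Int.eq_ofNat_of_zero_le hv
    have : z ((k : ℤ) + 1) = u (k + 1) := by exact_mod_cast hzu (k + 1)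
    rw [hzu, this]
    exact hu k
  · obtain ⟨k, hk⟩ := Int.eq_ofNat_of_zero_le (show 0 ≤ -v - 1 by omega)
    have h1 : v = -((k + 1 : ℕ) : ℤ) := by push_cast; omega
    have h2 : v + 1 = -(k : ℤ) := by omega
    rw [h2, h1, hzy, hzy]
    exact ⟨hyS _, hyG k⟩

/-- The words of length `n + 1` that are the labels of paths inside `S` in the graph of `E`. -/
def pathWords {A : Type} (E : A → A → Prop) (S : Set A) (n : ℕ) : Set (Fin (n + 1) → A) :=
  {w | (∀ i, w i ∈ S) ∧ ∀ i : Fin n, E (w i.castSucc) (w i.succ)}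

theorem snoc_mem_pathWords {A : Type} {E : A → A → Prop} {S : Set A} {n : ℕ}
    {w : Fin (n + 1) → A} {b : A} :
    (Fin.snoc w b : Fin (n + 2) → A) ∈ pathWords E S (n + 1) ↔
      w ∈ pathWords E S n ∧ b ∈ S ∧ E (w (Fin.last n)) b := by
  have h1 : (∀ i, (Fin.snoc w b : Fin (n + 2) → A) i ∈ S) ↔ (∀ i, w i ∈ S) ∧ b ∈ S := by
    rw [Fin.forall_fin_succ']
    simp
  have h2 : (∀ i : Fin (n + 1), E ((Fin.snoc w b : Fin (n + 2) → A) i.castSucc)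
      ((Fin.snoc w b : Fin (n + 2) → A) i.succ)) ↔
      (∀ i : Fin n, E (w i.castSucc) (w i.succ)) ∧ E (w (Fin.last n)) b := by
    rw [Fin.forall_fin_succ']
    simp only [Fin.snoc_castSucc, Fin.succ_last, Fin.snoc_last, Fin.succ_castSucc]
  change (_ ∧ _) ↔ (_ ∧ _) ∧ _
  rw [h1, h2]
  tauto

/-- Affine functions grow at their linear rate. -/
theorem tendsto_affine_div (c L : ℝ) :
    Tendsto (fun n : ℕ => (c + n * L) / ((n + 1 : ℕ) : ℝ)) atTop (nhds L) := by
  have h1 : Tendsto (fun n : ℕ => (c - L) / ((n + 1 : ℕ) : ℝ)) atTop (nhds 0) :=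
    (tendsto_const_nhds.div_atTop tendsto_natCast_atTop_atTop).comp (tendsto_add_atTop_nat 1)
  have h2 : Tendsto (fun n : ℕ => (c - L) / ((n + 1 : ℕ) : ℝ) + L) atTop (nhds (0 + L)) :=
    h1.add tendsto_const_nhds
  rw [zero_add] at h2
  refine h2.congr fun n => ?_
  have : ((n + 1 : ℕ) : ℝ) ≠ 0 := by positivity
  field_simp
  push_cast
  ring

/-- The number of paths inside a communicating class grows like the powers of its eigenvalue. -/
theorem IsPerronData.tendsto_log_ncard_pathWords {A : Type} [Fintype A] {E : A → A → Prop}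
    {lam r : A → ℝ} (h : IsPerronData E lam r) {a : A} (ha : a ∈ communicatingClass E a) :
    Tendsto (fun n : ℕ => Real.log ((pathWords E (communicatingClass E a) n).ncard : ℝ) /
      ((n + 1 : ℕ) : ℝ)) atTop (nhds (Real.log (lam a))) := by
  classical
  set S := communicatingClass E a with hS
  have hSr : ∀ b ∈ S, 0 < r b := fun b hb => h.vec_pos b (self_mem_of_mem_communicatingClass hb)
  have hlam := h.lam_pos a ha
  let T : (n : ℕ) → Finset (Fin (n + 1) → A) := fun n => (pathWords E S n).toFinset
  have hT : ∀ n w, w ∈ T n ↔ w ∈ pathWords E S n := fun n w => by simp [T]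
  have hcard : ∀ n, (pathWords E S n).ncard = (T n).card := fun n =>
    Set.ncard_eq_toFinset_card' _
  -- Weighting each path by `r` at its last letter turns the eigenvector equation into the exact
  -- recursion `W (n + 1) = lam a * W n`. On the class `r` lies between two positive constants, so
  -- `W` is comparable to the number of paths.
  let W : ℕ → ℝ := fun n => ∑ w ∈ T n, r (w (Fin.last n))
  have hW : ∀ n, W n = ∑ w, if w ∈ pathWords E S n then r (w (Fin.last n)) else 0 := fun n => by
    rw [← Finset.sum_filter]
    refine Finset.sum_congr ?_ fun _ _ => rfl
    ext w
    simp [T]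
  have hrec : ∀ n, W (n + 1) = lam a * W n := by
    intro n
    rw [hW, hW, sum_eq_sum_snoc, Finset.mul_sum]
    refine Finset.sum_congr rfl fun w _ => ?_
    simp only [snoc_mem_pathWords, Fin.snoc_last]
    by_cases hw : w ∈ pathWords E S n
    · have hl := hw.1 (Fin.last n)
      have hs := h.sum_eq _ (self_mem_of_mem_communicatingClass hl)
      rw [communicatingClass_eq_of_mem hl, h.lam_eq a _ hl, ← hS] at hs
      simp only [hw, true_and, if_true]
      rw [← hs]
    · simp [hw]
  have hWn : ∀ n, W n = lam a ^ n * W 0 := by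
    intro n
    induction n with
    | zero => simp
    | succ n ih => rw [hrec, ih, pow_succ]; ring
  have hW0 : 0 < W 0 := by
    refine Finset.sum_pos (fun w hw => hSr _ (((hT 0 w).1 hw).1 _)) ⟨fun _ => a, ?_⟩
    rw [hT]
    exact ⟨fun _ => ha, fun i => i.elim0⟩
  have hne : S.toFinset.Nonempty := ⟨a, by simpa using ha⟩
  obtain ⟨b, hbS, hb⟩ := S.toFinset.exists_min_image r hne
  obtain ⟨c, hcS, hc⟩ := S.toFinset.exists_max_image r hne
  have hrb : 0 < r b := hSr b (by simpa using hbS)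
  have hrc : 0 < r c := hSr c (by simpa using hcS)
  have hup : ∀ n, ((T n).card : ℝ) * r b ≤ lam a ^ n * W 0 := by
    intro n
    rw [← hWn, ← nsmul_eq_mul]
    exact Finset.card_nsmul_le_sum _ _ _ fun w hw => hb _ (by simpa using ((hT n w).1 hw).1 _)
  have hlow : ∀ n, lam a ^ n * W 0 ≤ ((T n).card : ℝ) * r c := by
    intro n
    rw [← hWn, ← nsmul_eq_mul]
    exact Finset.sum_le_card_nsmul _ _ _ fun w hw => hc _ (by simpa using ((hT n w).1 hw).1 _)
  have hcpos : ∀ n, 0 < ((T n).card : ℝ) := fun n =>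
    pos_of_mul_pos_left ((mul_pos (pow_pos hlam n) hW0).trans_le (hlow n)) hrc.le
  simp only [hcard]
  refine tendsto_of_tendsto_of_tendsto_of_le_of_le
    (tendsto_affine_div (Real.log (W 0 / r c)) (Real.log (lam a)))
    (tendsto_affine_div (Real.log (W 0 / r b)) (Real.log (lam a))) (fun n => ?_) (fun n => ?_)
  · refine div_le_div_of_nonneg_right ?_ (Nat.cast_nonneg _)
    rw [← Real.log_pow, ← Real.log_mul (div_pos hW0 hrc).ne' (pow_pos hlam n).ne']
    refine Real.log_le_log (by positivity) ?_
    rw [div_mul_eq_mul_div, div_le_iff₀ hrc, mul_comm (W 0)]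
    exact hlow n
  · refine div_le_div_of_nonneg_right ?_ (Nat.cast_nonneg _)
    rw [← Real.log_pow, ← Real.log_mul (div_pos hW0 hrb).ne' (pow_pos hlam n).ne']
    refine Real.log_le_log (hcpos n) ?_
    rw [div_mul_eq_mul_div, le_div_iff₀ hrb, mul_comm (W 0)]
    exact hup n

/-! ### One-dimensional blocks and topological entropy -/

/-- The block of length `n` of a point, read at the sites `1, …, n`. -/
def block {A : Type} (n : ℕ) (x : FullShift 1 A) : Fin n → A :=
  fun i => x fun _ => (i : ℤ) + 1

/-- The sites of a one-dimensional box. -/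
def boxEquiv (n : Fin 1 → ℕ) : Fin (n 0) ≃ box n where
  toFun i := ⟨fun _ => (i : ℤ) + 1, by
    rw [box, Fintype.mem_piFinset]
    intro j
    rw [Subsingleton.elim j 0, Finset.mem_Icc]
    have := i.2
    omega⟩
  invFun s := ⟨(s.1 0 - 1).toNat, by
    have := Fintype.mem_piFinset.1 s.2 0
    rw [Finset.mem_Icc] at this
    omega⟩
  left_inv i := by ext; simp
  right_inv s := by
    have := Fintype.mem_piFinset.1 s.2 0
    rw [Finset.mem_Icc] at this
    ext j
    rw [Subsingleton.elim j 0]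
    simp only
    omega

theorem ncard_languageOn_box {A : Type} (X : Set (FullShift 1 A)) (n : Fin 1 → ℕ) :
    (languageOn X (box n)).ncard = (block (n 0) '' X).ncard := by
  rw [← Set.ncard_image_of_injective (languageOn X (box n))
    ((boxEquiv n).arrowCongr (Equiv.refl A)).symm.injective]
  congr 1
  ext w
  constructor
  · rintro ⟨u, ⟨x, hx, hxu⟩, rfl⟩
    exact ⟨x, hx, funext fun i => hxu (boxEquiv n i)⟩
  · rintro ⟨x, hx, rfl⟩
    exact ⟨fun s => x s, ⟨x, hx, fun _ => rfl⟩, rfl⟩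

theorem tendsto_apply_atTop : Tendsto (fun n : Fin 1 → ℕ => n 0) atTop atTop :=
  tendsto_atTop_atTop.2 fun b => ⟨fun _ => b, fun _ h => h 0⟩

theorem topologicalEntropy_eq_of_tendsto {A : Type} {X : Set (FullShift 1 A)} {h : ℝ}
    (hX : Tendsto (fun n : ℕ => Real.log ((block n '' X).ncard : ℝ) / n) atTop (nhds h)) :
    topologicalEntropy X = h := by
  refine Tendsto.limUnder_eq ((hX.comp tendsto_apply_atTop).congr fun n => ?_)
  simp only [Function.comp_apply, ncard_languageOn_box, Fin.prod_univ_one]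

/-- The topological entropy of a subshift exists. -/
theorem tendsto_topologicalEntropy {A : Type} [Finite A] {X : Set (FullShift 1 A)}
    (hX : X.Nonempty) (hshift : ∀ t, ∀ x ∈ X, FullShift.shift t x ∈ X) :
    Tendsto (fun n : ℕ => Real.log ((block n '' X).ncard : ℝ) / n) atTop
      (nhds (topologicalEntropy X)) := by
  have hpos : ∀ n, 0 < (block n '' X).ncard := fun n =>
    (Set.ncard_pos (Set.toFinite _)).2 (hX.image _)
  -- A block of length `m + n` splits into a block of the point and a block of its shift by `m`;
  -- Fekete's lemma then gives the limit.
  have hsub : Subadditive fun n : ℕ => Real.log ((block n '' X).ncard : ℝ) := by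
    intro m n
    have hle : (block (m + n) '' X).ncard ≤ (block m '' X).ncard * (block n '' X).ncard := by
      rw [← Set.ncard_prod]
      refine Set.ncard_le_ncard_of_injOn
        (fun w => (fun i => w (Fin.castAdd n i), fun i => w (Fin.natAdd m i))) ?_ ?_
        (Set.toFinite _)
      · rintro _ ⟨x, hx, rfl⟩
        refine ⟨⟨x, hx, rfl⟩, ⟨_, hshift (fun _ => (m : ℤ)) x hx, ?_⟩⟩
        funext i
        simp only [block, FullShift.shift]
        congr 1
        funext _
        simp only [Pi.add_apply, Fin.val_natAdd]
        push_cast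
        ring
      · intro w _ w' _ hww
        rw [Prod.mk.injEq] at hww
        funext i
        induction i using Fin.addCases with
        | left i => exact congrFun hww.1 i
        | right i => exact congrFun hww.2 i
    rw [← Real.log_mul (by exact_mod_cast (hpos m).ne') (by exact_mod_cast (hpos n).ne')]
    exact Real.log_le_log (by exact_mod_cast hpos _) (by exact_mod_cast hle)
  have hlim := hsub.tendsto_lim ⟨0, by
    rintro _ ⟨n, rfl⟩
    exact div_nonneg (Real.log_natCast_nonneg _) (Nat.cast_nonneg n)⟩
  rwa [topologicalEntropy_eq_of_tendsto hlim]

/-! ### Invariant measures as stationary laws -/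

section Measure

variable {A : Type}

theorem measurable_eval (s : Fin 1 → ℤ) : @Measurable (FullShift 1 A) A _ ⊤ fun x => x s :=
  @measurable_pi_apply (Fin 1 → ℤ) (fun _ => A) (fun _ => ⊤) s

theorem measurableSet_eval_eq (s : Fin 1 → ℤ) (a : A) :
    MeasurableSet {x : FullShift 1 A | x s = a} := by
  let _ : MeasurableSpace A := ⊤
  exact measurable_eval s (show MeasurableSet ({a} : Set A) from trivial)

theorem measurableSet_block_eq {n : ℕ} (w : Fin n → A) :
    MeasurableSet {x : FullShift 1 A | block n x = w} := by
  have : {x : FullShift 1 A | block n x = w} =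
      ⋂ i : Fin n, {x | x (fun _ => (i : ℤ) + 1) = w i} := by
    ext x
    simp [block, funext_iff]
  rw [this]
  exact MeasurableSet.iInter fun i => measurableSet_eval_eq _ _

theorem sum_measureReal_inter_eval [Fintype A] (μ : Measure (FullShift 1 A)) [IsFiniteMeasure μ]
    {C : Set (FullShift 1 A)} (hC : MeasurableSet C) (s : Fin 1 → ℤ) :
    ∑ a, μ.real (C ∩ {x | x s = a}) = μ.real C := by
  rw [← measureReal_biUnion_finset]
  · congr 1
    ext x
    simp
  · intro a _ b _ hab
    exact Set.disjoint_left.2 fun x hxa hxb => hab (hxa.2.symm.trans hxb.2)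
  · exact fun a _ => hC.inter (measurableSet_eval_eq s a)

theorem block_eq_snoc_iff {n : ℕ} {x : FullShift 1 A} {w : Fin n → A} {b : A} :
    block (n + 1) x = Fin.snoc w b ↔ block n x = w ∧ x (fun _ => (n : ℤ) + 1) = b := by
  constructor
  · intro h
    refine ⟨funext fun i => ?_, ?_⟩
    · have := congrFun h i.castSucc
      rwa [Fin.snoc_castSucc] at this
    · have := congrFun h (Fin.last n)
      rwa [Fin.snoc_last] at this
  · rintro ⟨rfl, rfl⟩
    funext i
    induction i using Fin.lastCases with
    | last => rw [Fin.snoc_last]; rfl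
    | cast i => rw [Fin.snoc_castSucc]; rfl

theorem block_eq_cons_iff {n : ℕ} {x : FullShift 1 A} {w : Fin n → A} {a : A} :
    block (n + 1) x = Fin.cons a w ↔
      block n (FullShift.shift (fun _ => 1) x) = w ∧ x (fun _ => 1) = a := by
  have h0 : block (n + 1) x 0 = x fun _ => 1 := by
    simp [block]
  have hs : ∀ i : Fin n, block (n + 1) x i.succ = block n (FullShift.shift (fun _ => 1) x) i := by
    intro i
    simp only [block, FullShift.shift]
    congr 1
  constructor
  · intro h
    refine ⟨funext fun i => ?_, ?_⟩
    · rw [← hs, h, Fin.cons_succ]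
    · rw [← h0, h, Fin.cons_zero]
  · rintro ⟨rfl, rfl⟩
    funext i
    induction i using Fin.cases with
    | zero => rw [Fin.cons_zero, h0]
    | succ i => rw [Fin.cons_succ, hs]

/-- The block probabilities of an invariant probability measure. -/
noncomputable def blockLaw [Fintype A] (μ : Measure (FullShift 1 A)) [IsProbabilityMeasure μ]
    (hμ : ∀ t, MeasurePreserving (FullShift.shift t) μ μ) : StationaryLaw A where
  prob n w := μ.real {x | block n x = w}
  nonneg _ _ := measureReal_nonneg
  prob_zero w := by
    have : {x : FullShift 1 A | block 0 x = w} = Set.univ :=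
      Set.eq_univ_of_forall fun x => Subsingleton.elim _ _
    rw [this, probReal_univ]
  sum_snoc n w := by
    rw [← sum_measureReal_inter_eval μ (measurableSet_block_eq w) fun _ => (n : ℤ) + 1]
    refine Finset.sum_congr rfl fun b _ => ?_
    simp only [block_eq_snoc_iff]
    rfl
  sum_cons n w := by
    have h := (hμ fun _ => 1).measureReal_preimage (measurableSet_block_eq w).nullMeasurableSet
    rw [← h, ← sum_measureReal_inter_eval μ ((hμ fun _ => 1).measurable
      (measurableSet_block_eq w)) fun _ => 1]
    refine Finset.sum_congr rfl fun b _ => ?_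
    simp only [block_eq_cons_iff]
    rfl

theorem measureEntropy_eq_of_tendsto [Fintype A] {μ : Measure (FullShift 1 A)} {h : ℝ}
    (hμ : Tendsto (fun n : ℕ => (∑ w : Fin n → A, Real.negMulLog (μ.real {x | block n x = w})) / n)
      atTop (nhds h)) : measureEntropy μ = h := by
  refine Tendsto.limUnder_eq ((hμ.comp tendsto_apply_atTop).congr fun n => ?_)
  simp only [Function.comp_apply, Fin.prod_univ_one]
  congr 1
  refine Fintype.sum_equiv ((boxEquiv n).arrowCongr (Equiv.refl A)) _ _ fun w => ?_
  congr 2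
  ext x
  constructor
  · rintro rfl s
    simp only [Equiv.arrowCongr_apply, Equiv.coe_refl, Function.comp_apply, id_eq]
    conv_lhs => rw [← (boxEquiv n).apply_symm_apply s]
    rfl
  · intro hx
    funext i
    have := hx (boxEquiv n i)
    exact this.trans (by simp)

theorem measureEntropy_eq_entropyRate [Fintype A] (μ : Measure (FullShift 1 A))
    [IsProbabilityMeasure μ] (hμ : ∀ t, MeasurePreserving (FullShift.shift t) μ μ) :
    measureEntropy μ = (blockLaw μ hμ).entropyRate :=
  measureEntropy_eq_of_tendsto (blockLaw μ hμ).tendsto_blockEntropy_div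

theorem follows_of_pair_pos [Fintype A] {X : Set (FullShift 1 A)} (μ : Measure (FullShift 1 A))
    [IsProbabilityMeasure μ] (hμ : ∀ t, MeasurePreserving (FullShift.shift t) μ μ)
    (hX : μ Xᶜ = 0) {a b : A} (h : 0 < (blockLaw μ hμ).pair a b) : Follows X a b := by
  by_contra hF
  refine h.ne' ?_
  have hsub : {x : FullShift 1 A | block 2 x = Fin.snoc (fun _ : Fin 1 => a) b} ⊆ Xᶜ := by
    intro x hx hxX
    obtain ⟨h1, h2⟩ := block_eq_snoc_iff.1 hx
    refine hF ⟨x, hxX, fun _ => 1, ?_, ?_⟩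
    · have := congrFun h1 0
      simpa [block] using this
    · rw [← h2]
      congr 1
      funext j
      rw [Subsingleton.elim j 0]
      simp
  exact (measureReal_eq_zero_iff).2 (measure_mono_null hsub hX)

/-- An invariant probability measure is determined by its block probabilities. -/
theorem measure_eq_of_blockLaw_eq [Fintype A] (μ ν : Measure (FullShift 1 A))
    [IsProbabilityMeasure μ] [IsProbabilityMeasure ν]
    (hμ : ∀ t, MeasurePreserving (FullShift.shift t) μ μ)
    (hν : ∀ t, MeasurePreserving (FullShift.shift t) ν ν)
    (h : ∀ n w, (blockLaw μ hμ).prob n w = (blockLaw ν hν).prob n w) : μ = ν := by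
  let _ : MeasurableSpace A := ⊤
  have _ : DiscreteMeasurableSpace A := ⟨fun _ => trivial⟩
  have hmb : ∀ n, Measurable (block n : FullShift 1 A → Fin n → A) := fun n =>
    measurable_pi_lambda _ fun i => measurable_eval _
  have hblock : ∀ n, μ.map (block n) = ν.map (block n) := by
    intro n
    refine Measure.ext_of_singleton fun w => ?_
    rw [Measure.map_apply (hmb n) (measurableSet_singleton w),
      Measure.map_apply (hmb n) (measurableSet_singleton w)]
    exact (measureReal_eq_measureReal_iff).1 (h n w)
  have hrestr : ∀ I : Finset (Fin 1 → ℤ),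
      @Measure.map (FullShift 1 A) (I → A) _ _ I.restrict μ =
        @Measure.map (FullShift 1 A) (I → A) _ _ I.restrict ν := by
    intro I
    -- The sites of `I` lie in `[-N, N]`. The shift by `-(N + 1)` moves this window onto the sites
    -- `1, …, 2N + 1` of a block, and invariance removes the shift.
    let N : ℕ := ∑ i ∈ I, (i 0).natAbs
    have hN : ∀ i ∈ I, (i 0).natAbs ≤ N := fun i hi =>
      Finset.single_le_sum (f := fun i : Fin 1 → ℤ => (i 0).natAbs) (fun _ _ => Nat.zero_le _) hi
    let g : (Fin (2 * N + 1) → A) → I → A := fun w i =>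
      w ⟨(i.1 0 + N).toNat, by have := hN i.1 i.2; omega⟩
    have hg : Measurable g := Measurable.of_discrete
    have hfac : (I.restrict : FullShift 1 A → I → A) =
        g ∘ block (2 * N + 1) ∘ FullShift.shift fun _ => -((N : ℤ) + 1) := by
      funext x i
      change x i.1 = x _
      congr 1
      funext j
      have := hN i.1 i.2
      rw [Subsingleton.elim j 0]
      simp only [Pi.add_apply]
      omega
    rw [hfac, ← Measure.map_map hg ((hmb _).comp (hμ _).measurable),
      ← Measure.map_map hg ((hmb _).comp (hμ _).measurable),
      ← Measure.map_map (hmb _) (hμ _).measurable, ← Measure.map_map (hmb _) (hμ _).measurable,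
      (hμ _).map_eq, (hν _).map_eq, hblock]
  have hfin : ∀ I : Finset (Fin 1 → ℤ), IsFiniteMeasure
      (@Measure.map (FullShift 1 A) (I → A) _ _ I.restrict ν) := fun I =>
    Measure.isFiniteMeasure_map ν _
  exact IsProjectiveLimit.unique (α := fun _ : Fin 1 → ℤ => A)
    (P := fun I => @Measure.map (FullShift 1 A) (I → A) _ _ I.restrict ν) hrestr fun _ => rfl

end Measure

/-! ### Irreducible components and the lower bound -/

section Component

variable {A : Type} {X : Set (FullShift 1 A)}

/-- A pair that occurs in some point of `X` is not forbidden. The forbidden sets may thus be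
replaced by the graph, and points of `X` are exactly its bi-infinite paths. -/
theorem IsNearestNeighborSFT.mem_iff (hX : IsNearestNeighborSFT X) {x : FullShift 1 A} :
    x ∈ X ↔ ∀ v, Follows X (x v) (x (v + Pi.single 0 1)) := by
  refine ⟨fun hx v => ⟨x, hx, v, rfl, rfl⟩, fun h => ?_⟩
  obtain ⟨-, F, hF⟩ := hX
  rw [hF]
  intro i v
  obtain ⟨y, hy, u, hyu, hyu'⟩ := h v
  rw [hF] at hy
  have := hy i u
  rw [Subsingleton.elim i 0] at this ⊢
  rwa [hyu, hyu'] at this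

theorem IsNearestNeighborSFT.shift_mem (hX : IsNearestNeighborSFT X) (t : Fin 1 → ℤ)
    {x : FullShift 1 A} (hx : x ∈ X) : FullShift.shift t x ∈ X := by
  rw [hX.mem_iff] at hx ⊢
  intro v
  have := hx (v + t)
  rwa [add_right_comm] at this

/-- The irreducible component of a letter. -/
def componentOf (X : Set (FullShift 1 A)) (a : A) : Set (FullShift 1 A) :=
  {x ∈ X | ∀ v, x v ∈ communicatingClass (Follows X) a}

theorem isIrreducibleComponent_componentOf {a : A}
    (ha : a ∈ communicatingClass (Follows X) a) :
    IsIrreducibleComponent X (componentOf X a) :=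
  ⟨a, ha, rfl⟩

/-- Every letter of the class has a successor and a predecessor in the class, so a finite path
inside it extends in both directions to a point of the component. -/
theorem image_block_componentOf (hX : IsNearestNeighborSFT X) (a : A) (n : ℕ) :
    block (n + 1) '' componentOf X a =
      pathWords (Follows X) (communicatingClass (Follows X) a) n := by
  set S := communicatingClass (Follows X) a with hS
  ext w
  constructor
  · rintro ⟨x, ⟨hxX, hxS⟩, rfl⟩
    refine ⟨fun i => hxS _, fun i => ⟨x, hxX, fun _ => (i : ℤ) + 1, rfl, ?_⟩⟩
    simp only [block]
    congr 1
    funext j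
    rw [Subsingleton.elim j 0]
    simp
  · rintro ⟨hwS, hw⟩
    have hsucc : ∀ b ∈ S, ∃ c ∈ S, Follows X b c := by
      intro b hb
      obtain ⟨c, hc, -⟩ := Relation.TransGen.head'_iff.1
        (transGen_within_communicatingClass hb hb)
      exact ⟨c, hc.2.2, hc.1⟩
    have hpred : ∀ c ∈ S, ∃ b ∈ S, Follows X b c := by
      intro c hc
      obtain ⟨b, -, hb⟩ := Relation.TransGen.tail'_iff.1
        (transGen_within_communicatingClass hc hc)
      exact ⟨b, hb.2.1, hb.1⟩
    obtain ⟨u, hu, huw⟩ := exists_nat_path_extending (Follows X) S hsucc w hwS hw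
    obtain ⟨z, hz, hzu⟩ := exists_int_path_extending (Follows X) S hpred u hu
    -- Blocks are read from site `1`, whereas paths are indexed from `0`.
    refine ⟨fun s => z (s 0 - 1), ⟨hX.mem_iff.2 fun v => ?_, fun v => (hz _).1⟩, funext fun i => ?_⟩
    · have := (hz (v 0 - 1)).2
      rw [show v 0 - 1 + 1 = (v + Pi.single 0 1 : Fin 1 → ℤ) 0 - 1 by simp] at this
      exact this
    · simp only [block, add_sub_cancel_right]
      rw [hzu, huw]

theorem topologicalEntropy_componentOf [Fintype A] (hX : IsNearestNeighborSFT X)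
    {lam r : A → ℝ} (h : IsPerronData (Follows X) lam r) {a : A}
    (ha : a ∈ communicatingClass (Follows X) a) :
    topologicalEntropy (componentOf X a) = Real.log (lam a) := by
  refine topologicalEntropy_eq_of_tendsto ((tendsto_add_atTop_iff_nat 1).1 ?_)
  simp only [image_block_componentOf hX]
  exact h.tendsto_log_ncard_pathWords ha

theorem log_eigenvalue_le_topologicalEntropy [Fintype A] (hX : IsNearestNeighborSFT X)
    {lam r : A → ℝ} (h : IsPerronData (Follows X) lam r) {a : A}
    (ha : a ∈ communicatingClass (Follows X) a) :
    Real.log (lam a) ≤ topologicalEntropy X := by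
  have h1 := (tendsto_add_atTop_iff_nat 1).2
    (tendsto_topologicalEntropy hX.1 fun t x hx => hX.shift_mem t hx)
  refine le_of_tendsto_of_tendsto' (h.tendsto_log_ncard_pathWords ha) h1 fun n => ?_
  refine div_le_div_of_nonneg_right ?_ (Nat.cast_nonneg _)
  rw [← image_block_componentOf hX]
  have hmono : (block (n + 1) '' componentOf X a).ncard ≤ (block (n + 1) '' X).ncard :=
    Set.ncard_le_ncard (Set.image_mono fun x hx => hx.1) (Set.toFinite _)
  rcases Nat.eq_zero_or_pos (block (n + 1) '' componentOf X a).ncard with h0 | h0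
  · rw [h0, Nat.cast_zero, Real.log_zero]
    exact Real.log_natCast_nonneg _
  · exact Real.log_le_log (by exact_mod_cast h0) (by exact_mod_cast hmono)

theorem componentOf_nonempty (hX : IsNearestNeighborSFT X) {a : A}
    (ha : a ∈ communicatingClass (Follows X) a) : (componentOf X a).Nonempty := by
  have : (fun _ => a) ∈ pathWords (Follows X) (communicatingClass (Follows X) a) 0 :=
    ⟨fun _ => ha, fun i => i.elim0⟩
  rw [← image_block_componentOf hX] at this
  exact Set.image_nonempty.1 ⟨_, this⟩

theorem componentOf_ne (hX : IsNearestNeighborSFT X) {a c : A}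
    (ha : a ∈ communicatingClass (Follows X) a) (hac : a ∉ communicatingClass (Follows X) c) :
    componentOf X a ≠ componentOf X c := by
  intro heq
  obtain ⟨x, hx⟩ := componentOf_nonempty hX ha
  have h1 := hx.2 0
  rw [heq] at hx
  have h2 := hx.2 0
  rw [← communicatingClass_eq_of_mem h2, communicatingClass_eq_of_mem h1] at hac
  exact hac ha

/-- A nearest neighbor `ℤ` SFT with several measures of maximal entropy has two communicating
classes of maximal entropy. -/
theorem exists_two_classes_of_hasMultipleMME [Fintype A] (hX : IsNearestNeighborSFT X)
    (hM : HasMultipleMME X) {lam r : A → ℝ} (h : IsPerronData (Follows X) lam r) :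
    ∃ a c, a ∈ communicatingClass (Follows X) a ∧ c ∈ communicatingClass (Follows X) c ∧
      a ∉ communicatingClass (Follows X) c ∧ Real.log (lam a) = topologicalEntropy X ∧
      Real.log (lam c) = topologicalEntropy X := by
  obtain ⟨μ, ν, hμ, hν, hne⟩ := hM
  have := hμ.isProbabilityMeasure
  have := hν.isProbabilityMeasure
  let p := blockLaw μ hμ.invariant
  let q := blockLaw ν hν.invariant
  have hp : p.entropyRate = topologicalEntropy X := by
    rw [← hμ.entropy_eq, measureEntropy_eq_entropyRate μ hμ.invariant]
  have hq : q.entropyRate = topologicalEntropy X := by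
    rw [← hν.entropy_eq, measureEntropy_eq_entropyRate ν hν.invariant]
  have hpE : ∀ a b, 0 < p.pair a b → Follows X a b := fun a b =>
    follows_of_pair_pos μ hμ.invariant hμ.supported
  have hqE : ∀ a b, 0 < q.pair a b → Follows X a b := fun a b =>
    follows_of_pair_pos ν hν.invariant hν.supported
  have hmax : ∀ a, a ∈ communicatingClass (Follows X) a → Real.log (lam a) ≤ p.entropyRate :=
    fun a ha => hp ▸ log_eigenvalue_le_topologicalEntropy hX h ha
  obtain ⟨c, hc⟩ : ∃ c, 0 < p.letter c := by
    by_contra! hle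
    have := Finset.sum_nonpos fun a (_ : a ∈ Finset.univ) => hle a
    rw [p.sum_letter] at this
    linarith
  have hcc := p.mem_communicatingClass_of_letter_pos hpE hc
  have hlc := (p.markov_of_le_entropyRate hpE h hmax).1 c hc
  -- If the class of `c` were the only one of maximal entropy, the two measures would have the same
  -- block probabilities.
  by_contra! hcon
  refine hne (measure_eq_of_blockLaw_eq μ ν hμ.invariant hν.invariant
    (p.prob_eq_of_unique_class q h hpE hqE (hp.trans hq.symm) hmax c fun a ha hla => ?_))
  by_contra hac
  exact hcon a c ha hcc hac (hla.trans hp) (hlc.trans hp)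

/-- The two classes are disjoint and have the same eigenvalue, of logarithm `h(X)`. Each has at
least that many letters, so twice the eigenvalue is at most `|A|`. -/
theorem two_components_of_hasMultipleMME [Fintype A] (hX : IsNearestNeighborSFT X)
    (hM : HasMultipleMME X) :
    (∃ Y Z : Set (FullShift 1 A), IsIrreducibleComponent X Y ∧ IsIrreducibleComponent X Z ∧
      Y ≠ Z ∧ topologicalEntropy Y = topologicalEntropy X ∧
      topologicalEntropy Z = topologicalEntropy X) ∧
    Real.log (Fintype.card A) - topologicalEntropy X ≥ Real.log 2 := by
  obtain ⟨lam, r, h⟩ := exists_isPerronData (Follows X)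
  obtain ⟨a, c, ha, hc, hac, hla, hlc⟩ := exists_two_classes_of_hasMultipleMME hX hM h
  refine ⟨⟨componentOf X a, componentOf X c,
    isIrreducibleComponent_componentOf ha, isIrreducibleComponent_componentOf hc,
    componentOf_ne hX ha hac, ?_, ?_⟩, ?_⟩
  · rw [topologicalEntropy_componentOf hX h ha, hla]
  · rw [topologicalEntropy_componentOf hX h hc, hlc]
  · have hdisj : Disjoint (communicatingClass (Follows X) a) (communicatingClass (Follows X) c) := by
      refine Set.disjoint_left.2 fun b hba hbc => hac ?_
      rwa [← communicatingClass_eq_of_mem hbc, communicatingClass_eq_of_mem hba]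
    have hcard : (communicatingClass (Follows X) a).ncard +
        (communicatingClass (Follows X) c).ncard ≤ Fintype.card A := by
      rw [← Set.ncard_union_eq hdisj (Set.toFinite _) (Set.toFinite _), ← Nat.card_eq_fintype_card,
        ← Set.ncard_univ]
      exact Set.ncard_le_ncard (Set.subset_univ _) (Set.toFinite _)
    have hcard' : ((communicatingClass (Follows X) a).ncard : ℝ) +
        (communicatingClass (Follows X) c).ncard ≤ Fintype.card A := by exact_mod_cast hcard
    have hap := h.lam_pos a ha
    have heq : lam a = lam c :=
      Real.log_injOn_pos hap (h.lam_pos c hc) (hla.trans hlc.symm)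
    have h2 : 2 * lam a ≤ Fintype.card A := by
      have := h.lam_le_ncard ha
      have := h.lam_le_ncard hc
      linarith
    have := Real.log_le_log (by positivity) h2
    rw [Real.log_mul two_ne_zero hap.ne', hla] at this
    linarith

end Component

/-! ### Bernoulli measures -/

/-- The law of a sequence of independent letters of law `κ`. -/
noncomputable def bernoulliMeasure {A : Type} (κ : @Measure A ⊤) : Measure (FullShift 1 A) :=
  @Measure.infinitePi (Fin 1 → ℤ) (fun _ => A) (fun _ => ⊤) fun _ => κ

section Bernoulli

variable {A : Type} {κ : @Measure A ⊤}

theorem isProbabilityMeasure_bernoulliMeasure (hκ : @IsProbabilityMeasure A ⊤ κ) :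
    IsProbabilityMeasure (bernoulliMeasure κ) := by
  let _ : MeasurableSpace A := ⊤
  exact inferInstanceAs (IsProbabilityMeasure (Measure.infinitePi fun _ : Fin 1 → ℤ => κ))

theorem bernoulliMeasure_pi (hκ : @IsProbabilityMeasure A ⊤ κ) (s : Finset (Fin 1 → ℤ))
    (t : (Fin 1 → ℤ) → Set A) :
    bernoulliMeasure κ {x | ∀ i ∈ s, x i ∈ t i} = ∏ i ∈ s, κ (t i) := by
  let _ : MeasurableSpace A := ⊤
  exact Measure.infinitePi_pi (fun _ : Fin 1 → ℤ => κ) fun i _ => trivial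

theorem measurable_shift (t : Fin 1 → ℤ) :
    Measurable (FullShift.shift t : FullShift 1 A → FullShift 1 A) :=
  @measurable_pi_lambda _ _ _ _ (fun _ => ⊤) _ fun s => measurable_eval (s + t)

theorem measurePreserving_shift_bernoulliMeasure (hκ : @IsProbabilityMeasure A ⊤ κ)
    (t : Fin 1 → ℤ) :
    MeasurePreserving (FullShift.shift t) (bernoulliMeasure κ) (bernoulliMeasure κ) := by
  let _ : MeasurableSpace A := ⊤
  refine ⟨measurable_shift t, Measure.eq_infinitePi (fun _ : Fin 1 → ℤ => κ) fun s T hT => ?_⟩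
  refine (Measure.map_apply (measurable_shift t)
    (MeasurableSet.pi s.countable_toSet fun i _ => hT i)).trans ?_
  -- A condition at site `i` of the shifted point is a condition at site `i + t` of the point
  -- itself, whence the translated set of sites and the index `i - t`.
  have h := bernoulliMeasure_pi hκ (s.map (Equiv.addRight t).toEmbedding) fun i => T (i - t)
  rw [Finset.prod_map] at h
  simp only [Equiv.coe_toEmbedding, Equiv.coe_addRight, add_sub_cancel_right] at h
  rw [← h]
  congr 1
  ext x
  simp only [Finset.mem_map, Equiv.coe_toEmbedding, Equiv.coe_addRight, forall_exists_index, and_imp,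
    forall_apply_eq_imp_iff₂, add_sub_cancel_right]
  rfl

theorem bernoulliMeasure_block (hκ : @IsProbabilityMeasure A ⊤ κ) {n : ℕ} (w : Fin n → A) :
    bernoulliMeasure κ {x | block n x = w} = ∏ i, κ {w i} := by
  let site : Fin n ↪ (Fin 1 → ℤ) := ⟨fun i _ => (i : ℤ) + 1, fun i j hij => by
    have := congrFun hij 0
    simp only at this
    exact Fin.ext (by omega)⟩
  -- The product formula needs a set at every site: this one is `{w i}` at `site i` and everything
  -- off the range of `site`.
  have h := bernoulliMeasure_pi hκ (Finset.univ.map site) fun s => {a | ∀ i, site i = s → a = w i}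
  have hT : ∀ j, {a | ∀ i, site i = site j → a = w i} = {w j} := by
    intro j
    ext a
    exact ⟨fun ha => ha j rfl, fun ha i hi => by rw [site.injective hi]; exact ha⟩
  rw [Finset.prod_map] at h
  simp only [hT] at h
  rw [← h]
  congr 1
  ext x
  constructor
  · rintro rfl s hs i rfl
    rfl
  · intro hx
    funext i
    exact hx (site i) (Finset.mem_map_of_mem _ (Finset.mem_univ i)) i rfl

theorem bernoulliMeasure_forall_compl (hκ : @IsProbabilityMeasure A ⊤ κ) {T : Set A}
    (hT : κ Tᶜ = 0) : bernoulliMeasure κ {x | ∀ v, x v ∈ T}ᶜ = 0 := by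
  have : {x : FullShift 1 A | ∀ v, x v ∈ T}ᶜ = ⋃ v, {x | ∀ i ∈ ({v} : Finset _), x i ∈ Tᶜ} := by
    ext x
    simp
  rw [this]
  refine measure_iUnion_null fun v => ?_
  rw [bernoulliMeasure_pi hκ]
  simpa using hT

end Bernoulli

/-! ### Entropy of uniform Bernoulli measures -/

section Uniform

variable {A : Type} {n : ℕ}

/-- The uniform distribution on the image of an injection of `Fin n`. -/
noncomputable def uniformImage (f : Fin n → A) : @Measure A ⊤ :=
  @Measure.map _ _ _ ⊤ f (ProbabilityTheory.uniformOn Set.univ)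

theorem uniformImage_apply (f : Fin n → A) (T : Set A) :
    uniformImage f T = ProbabilityTheory.uniformOn Set.univ (f ⁻¹' T) := by
  let _ : MeasurableSpace A := ⊤
  exact Measure.map_apply Measurable.of_discrete trivial

theorem isProbabilityMeasure_uniformImage (hn : 1 ≤ n) (f : Fin n → A) :
    @IsProbabilityMeasure A ⊤ (uniformImage f) := by
  have : Nonempty (Fin n) := ⟨⟨0, hn⟩⟩
  let _ : MeasurableSpace A := ⊤
  have := ProbabilityTheory.isProbabilityMeasure_uniformOn (s := (Set.univ : Set (Fin n)))
    Set.finite_univ Set.univ_nonempty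
  exact Measure.isProbabilityMeasure_map Measurable.of_discrete.aemeasurable

theorem uniformImage_singleton {f : Fin n → A} (hf : Function.Injective f) (i : Fin n) :
    uniformImage f {f i} = (n : ENNReal)⁻¹ := by
  rw [uniformImage_apply, ← Set.image_singleton, hf.preimage_image,
    ProbabilityTheory.uniformOn_univ]
  simp

theorem uniformImage_compl_range (f : Fin n → A) : uniformImage f (Set.range f)ᶜ = 0 := by
  rw [uniformImage_apply]
  have : f ⁻¹' (Set.range f)ᶜ = ∅ := by
    ext i
    simp
  rw [this, measure_empty]

theorem uniformImage_singleton_of_notMem {f : Fin n → A} {a : A} (ha : a ∉ Set.range f) :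
    uniformImage f {a} = 0 :=
  measure_mono_null (by rintro _ rfl; exact ha) (uniformImage_compl_range f)

/-- Exactly `n ^ k` blocks of length `k` have positive mass, each of mass `n⁻¹ ^ k`, so the block
entropy is `k * log n`. The quotient is constant only for `k > 0`, division by zero giving `0`. -/
theorem measureEntropy_bernoulliMeasure_uniformImage [Fintype A] (hn : 1 ≤ n) {f : Fin n → A}
    (hf : Function.Injective f) :
    measureEntropy (bernoulliMeasure (uniformImage f)) = Real.log n := by
  have hκ := isProbabilityMeasure_uniformImage hn f
  have hn0 : (n : ℝ) ≠ 0 := by positivity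
  refine measureEntropy_eq_of_tendsto
    (Tendsto.congr' ?_ (tendsto_const_nhds (x := Real.log (n : ℝ))))
  filter_upwards [eventually_gt_atTop 0] with k hk
  have hk0 : (k : ℝ) ≠ 0 := by positivity
  have hprob : ∀ w : Fin k → A, (bernoulliMeasure (uniformImage f)).real {x | block k x = w} =
      ∏ i, (uniformImage f {w i}).toReal := fun w => by
    rw [measureReal_def, bernoulliMeasure_block hκ, ENNReal.toReal_prod]
  have hsum : ∑ w : Fin k → A, Real.negMulLog
      ((bernoulliMeasure (uniformImage f)).real {x | block k x = w}) =
      ∑ u : Fin k → Fin n, Real.negMulLog (((n : ℝ)⁻¹) ^ k) := by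
    symm
    refine Fintype.sum_of_injective (fun u i => f (u i)) (fun u v huv => ?_) _ _ (fun w hw => ?_)
      fun u => ?_
    · funext i
      exact hf (congrFun huv i)
    · rw [hprob]
      obtain ⟨i, hi⟩ : ∃ i, w i ∉ Set.range f := by
        by_contra! hall
        choose u hu using hall
        exact hw ⟨u, funext hu⟩
      rw [Finset.prod_eq_zero (Finset.mem_univ i), Real.negMulLog_zero]
      rw [uniformImage_singleton_of_notMem hi, ENNReal.toReal_zero]
    · rw [hprob]
      simp [uniformImage_singleton hf]
  rw [hsum, Finset.sum_const, Finset.card_univ, Fintype.card_fun, Fintype.card_fin,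
    Fintype.card_fin, nsmul_eq_mul, Real.negMulLog, Real.log_pow, Real.log_inv, inv_pow]
  push_cast
  field_simp

end Uniform

/-! ### The extremal example -/

section TwoFullShifts

theorem twoFullShifts_eq (n : ℕ) : twoFullShifts n =
    {x | ∀ v, x v ∈ Set.range Sum.inl} ∪ {x | ∀ v, x v ∈ Set.range Sum.inr} := by
  ext x
  simp only [twoFullShifts, Set.mem_union, Set.mem_ofPred_eq, Set.mem_range, eq_comm]

theorem isNearestNeighborSFT_twoFullShifts {n : ℕ} (hn : 1 ≤ n) :
    IsNearestNeighborSFT (twoFullShifts n) := by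
  refine ⟨⟨fun _ => Sum.inl ⟨0, hn⟩, Or.inl fun _ => ⟨_, rfl⟩⟩,
    fun _ => {q | q.1.isLeft ≠ q.2.isLeft}, ?_⟩
  ext x
  constructor
  · rintro (hx | hx) i v
    · obtain ⟨a, ha⟩ := hx v
      obtain ⟨b, hb⟩ := hx (v + Pi.single i 1)
      simp [ha, hb]
    · obtain ⟨a, ha⟩ := hx v
      obtain ⟨b, hb⟩ := hx (v + Pi.single i 1)
      simp [ha, hb]
  · intro hx
    have hstep : ∀ k : ℤ, (x fun _ => k).isLeft = (x fun _ => k + 1).isLeft := by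
      intro k
      have := hx 0 fun _ => k
      simp only [Set.mem_ofPred_eq, ne_eq, not_not] at this
      rw [this]
      congr 2
      funext j
      rw [Subsingleton.elim j 0]
      simp
    have hconst : ∀ k : ℤ, (x fun _ => k).isLeft = (x fun _ => 0).isLeft := by
      intro k
      induction k using Int.induction_on with
      | zero => rfl
      | succ k ih => rw [← ih, ← hstep]
      | pred k ih => rw [← ih, hstep (-(k : ℤ) - 1), sub_add_cancel]
    have hconst' : ∀ v, (x v).isLeft = (x fun _ => 0).isLeft := by
      intro v
      rw [← hconst (v 0)]
      congr 2
      funext j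
      rw [Subsingleton.elim j 0]
    cases h0 : (x fun _ => 0).isLeft with
    | true =>
      refine Or.inl fun v => ?_
      exact Sum.isLeft_iff.1 ((hconst' v).trans h0)
    | false =>
      refine Or.inr fun v => ?_
      exact Sum.isRight_iff.1 (by rw [← Sum.not_isLeft, hconst' v, h0]; simp)

theorem ncard_image_block_forall_range {A : Type} {n : ℕ} {f : Fin n → A}
    (hf : Function.Injective f) (k : ℕ) (hn : 1 ≤ n) :
    (block k '' {x : FullShift 1 A | ∀ v, x v ∈ Set.range f}).ncard = n ^ k := by
  have : block k '' {x : FullShift 1 A | ∀ v, x v ∈ Set.range f} =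
      Set.range fun (u : Fin k → Fin n) i => f (u i) := by
    ext w
    constructor
    · rintro ⟨x, hx, rfl⟩
      choose u hu using hx
      exact ⟨fun i => u _, funext fun i => hu _⟩
    · rintro ⟨u, rfl⟩
      -- Sites to the left of `1` are truncated to index `0`; indices from `k` on get a default
      -- letter, which exists because `1 ≤ n`.
      refine ⟨fun s => f (if h : (s 0 - 1).toNat < k then u ⟨_, h⟩ else ⟨0, hn⟩),
        fun v => ⟨_, rfl⟩, funext fun i => ?_⟩
      simp [block]
  rw [this, ← Set.image_univ, Set.ncard_image_of_injective _ fun u v huv =>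
    funext fun i => hf (congrFun huv i), Set.ncard_univ]
  simp

/-- The number of words of length `k` lies between `n ^ k` and `2 * n ^ k`, and the factor `2`
disappears in the limit. -/
theorem topologicalEntropy_twoFullShifts {n : ℕ} (hn : 1 ≤ n) :
    topologicalEntropy (twoFullShifts n) = Real.log n := by
  have hn0 : (0 : ℝ) < n := by exact_mod_cast hn
  have hlow : ∀ k, n ^ k ≤ (block k '' twoFullShifts n).ncard := by
    intro k
    rw [← ncard_image_block_forall_range (Sum.inl_injective (α := Fin n) (β := Fin n)) k hn,
      twoFullShifts_eq]
    exact Set.ncard_le_ncard (Set.image_mono Set.subset_union_left) (Set.toFinite _)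
  have hup : ∀ k, (block k '' twoFullShifts n).ncard ≤ 2 * n ^ k := by
    intro k
    rw [twoFullShifts_eq, Set.image_union, two_mul]
    refine (Set.ncard_union_le _ _).trans ?_
    rw [ncard_image_block_forall_range Sum.inl_injective k hn,
      ncard_image_block_forall_range Sum.inr_injective k hn]
  refine topologicalEntropy_eq_of_tendsto ((tendsto_add_atTop_iff_nat 1).1 ?_)
  refine tendsto_of_tendsto_of_tendsto_of_le_of_le
    (tendsto_affine_div (Real.log n) (Real.log n))
    (tendsto_affine_div (Real.log 2 + Real.log n) (Real.log n)) (fun k => ?_) (fun k => ?_)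
  · refine div_le_div_of_nonneg_right ?_ (Nat.cast_nonneg _)
    have h : ((n : ℝ) ^ (k + 1)) ≤ (block (k + 1) '' twoFullShifts n).ncard := by
      exact_mod_cast hlow (k + 1)
    have := Real.log_le_log (by positivity) h
    rw [Real.log_pow] at this
    push_cast at this
    linarith
  · refine div_le_div_of_nonneg_right ?_ (Nat.cast_nonneg _)
    have h : ((block (k + 1) '' twoFullShifts n).ncard : ℝ) ≤ 2 * (n : ℝ) ^ (k + 1) := by
      exact_mod_cast hup (k + 1)
    have hpos : (0 : ℝ) < (block (k + 1) '' twoFullShifts n).ncard := by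
      exact_mod_cast (pow_pos hn (k + 1)).trans_le (hlow (k + 1))
    have := Real.log_le_log hpos h
    rw [Real.log_mul two_ne_zero (by positivity), Real.log_pow] at this
    push_cast at this
    linarith

theorem isMeasureOfMaximalEntropy_twoFullShifts {n : ℕ} (hn : 1 ≤ n) {f : Fin n → Fin n ⊕ Fin n}
    (hf : Function.Injective f)
    (hsub : {x : FullShift 1 (Fin n ⊕ Fin n) | ∀ v, x v ∈ Set.range f} ⊆ twoFullShifts n) :
    IsMeasureOfMaximalEntropy (twoFullShifts n) (bernoulliMeasure (uniformImage f)) where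
  isProbabilityMeasure :=
    isProbabilityMeasure_bernoulliMeasure (isProbabilityMeasure_uniformImage hn f)
  invariant := measurePreserving_shift_bernoulliMeasure (isProbabilityMeasure_uniformImage hn f)
  supported := measure_mono_null (Set.compl_subset_compl.2 hsub)
    (bernoulliMeasure_forall_compl (isProbabilityMeasure_uniformImage hn f)
      (uniformImage_compl_range f))
  entropy_eq := by
    rw [measureEntropy_bernoulliMeasure_uniformImage hn hf, topologicalEntropy_twoFullShifts hn]

/-- The uniform Bernoulli measures on the two sides differ because they give full mass to disjoint
sets of sequences. -/
theorem hasMultipleMME_twoFullShifts {n : ℕ} (hn : 1 ≤ n) : HasMultipleMME (twoFullShifts n) := by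
  refine ⟨bernoulliMeasure (uniformImage Sum.inl), bernoulliMeasure (uniformImage Sum.inr),
    isMeasureOfMaximalEntropy_twoFullShifts hn Sum.inl_injective ?_,
    isMeasureOfMaximalEntropy_twoFullShifts hn Sum.inr_injective ?_, fun heq => ?_⟩
  · rw [twoFullShifts_eq]
    exact Set.subset_union_left
  · rw [twoFullShifts_eq]
    exact Set.subset_union_right
  · have hl := bernoulliMeasure_forall_compl
      (isProbabilityMeasure_uniformImage hn (Sum.inl : Fin n → Fin n ⊕ Fin n))
      (uniformImage_compl_range _)
    have hr := bernoulliMeasure_forall_compl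
      (isProbabilityMeasure_uniformImage hn (Sum.inr : Fin n → Fin n ⊕ Fin n))
      (uniformImage_compl_range _)
    rw [← heq] at hr
    have hprob := isProbabilityMeasure_bernoulliMeasure
      (isProbabilityMeasure_uniformImage hn (Sum.inl : Fin n → Fin n ⊕ Fin n))
    have huniv := measure_union_null hl hr
    rw [← Set.compl_inter] at huniv
    have hempty : {x : FullShift 1 (Fin n ⊕ Fin n) | ∀ v, x v ∈ Set.range Sum.inl} ∩
        {x | ∀ v, x v ∈ Set.range Sum.inr} = ∅ := by
      refine Set.eq_empty_of_forall_notMem fun x hx => ?_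
      obtain ⟨a, ha⟩ := hx.1 0
      obtain ⟨b, hb⟩ := hx.2 0
      exact Sum.inl_ne_inr (ha.trans hb.symm)
    rw [hempty, Set.compl_empty, measure_univ] at huniv
    exact one_ne_zero huniv

theorem log_card_sub_topologicalEntropy_twoFullShifts {n : ℕ} (hn : 1 ≤ n) :
    Real.log (Fintype.card (Fin n ⊕ Fin n)) - topologicalEntropy (twoFullShifts n) =
      Real.log 2 := by
  have hn0 : (n : ℝ) ≠ 0 := by positivity
  rw [topologicalEntropy_twoFullShifts hn, Fintype.card_sum, Fintype.card_fin, ← two_mul,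
    Nat.cast_mul, Nat.cast_two, Real.log_mul two_ne_zero hn0, add_sub_cancel_right]

end TwoFullShifts

/-! ### The main theorem -/

theorem theorem5p2 :
    alphaCrit 1 = Real.log 2 ∧
    (∀ (A : Type) [Fintype A] (X : Set (FullShift 1 A)),
      IsNearestNeighborSFT X → HasMultipleMME X →
        (∃ Y Z : Set (FullShift 1 A), IsIrreducibleComponent X Y ∧ IsIrreducibleComponent X Z ∧
          Y ≠ Z ∧ topologicalEntropy Y = topologicalEntropy X ∧
          topologicalEntropy Z = topologicalEntropy X) ∧
        Real.log (Fintype.card A) - topologicalEntropy X ≥ Real.log 2) ∧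
    (∀ n : ℕ, 1 ≤ n →
      IsNearestNeighborSFT (twoFullShifts n) ∧ HasMultipleMME (twoFullShifts n) ∧
        Real.log (Fintype.card (Fin n ⊕ Fin n)) - topologicalEntropy (twoFullShifts n) =
          Real.log 2) := by
  refine ⟨?_, fun A _ X hX hM => two_components_of_hasMultipleMME hX hM, fun n hn =>
    ⟨isNearestNeighborSFT_twoFullShifts hn, hasMultipleMME_twoFullShifts hn,
      log_card_sub_topologicalEntropy_twoFullShifts hn⟩⟩
  -- The infimum is attained, already by two fixed points (`n = 1`), and the bound for multiple
  -- measures shows that nothing smaller occurs.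
  refine IsLeast.csInf_eq ⟨⟨Fin 1 ⊕ Fin 1, inferInstance, twoFullShifts 1,
    isNearestNeighborSFT_twoFullShifts le_rfl, hasMultipleMME_twoFullShifts le_rfl, ?_⟩, ?_⟩
  · have := log_card_sub_topologicalEntropy_twoFullShifts (n := 1) le_rfl
    linarith
  · rintro α ⟨A, _, X, hX, hM, hα⟩
    have := (two_components_of_hasMultipleMME hX hM).2
    linarith
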